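/- Let $k$ be an infinite field (for instance an algebraically closed one), let $t\ge 1$ and let $d=(d_1,\dots,d_t)$ be a vector of non-negative integers. Let $$\mathcal R(Q,d)=\bigoplus_{i=1}^{t-1}\operatorname{Hom}(k^{d_{i+1}},k^{d_i})$$ be the space of representations $A=(A_{1,2},\dots,A_{t-1,t})$ of dimension vector $d$ of the quiver of type $\mathbb A_t$ with arrows $i+1\to i$, regarded as an affine space with its Zariski topology. For $i<j$ put $A_{(i,j)}=A_{i,i+1}A_{i+1,i+2}\cdots A_{j-1,j}$ and $r_{i,j}=\min\{d_l\mid i\le l\le j\}$. Let $$\mathcal O(d)=\{A\in\mathcal R(Q,d)\mid \operatorname{rk}A_{(i,j)}=r_{i,j}\text{ for all }1\le i<j\le t\}$$ be the generic orbit, and let $Y=\mathcal R(Q,d)\setminus\mathcal O(d)$ be its complement. The multisegment $M(d)=\bigoplus_{i\le j}[i,j]^{a_{i,j}}$ corresponding to $\mathcal O(d)$ is obtained as follows: take the diagram with $d_l$ vertices (in the rows $1,\dots,d_l$) in column $l$, for $1\le l\le t$, and connect any two vertices that lie in the same row and in neighbouring columns; then $a_{i,j}$ is the number of connected components of this diagram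 that occupy exactly the columns $i,i+1,\dots,j$. The dimension vector $d$ is called generic if $M(d)$ contains precisely $t$ pairwise different segments, i.e. if $a_{i,j}>0$ for exactly $t$ pairs $i\le j$. If $d$ is generic, then $Y$ has exactly $t-1$ irreducible components, and each of them has codimension at least $2$ in $\mathcal R(Q,d)$. (The codimension of an irreducible subset $Z$ is the height of the prime ideal of all polynomials over $k$ in the matrix entries that vanish on $Z$.) -/

import Mathlib

/-! Representations of the linearly oriented quiver `1 ← 2 ← ⋯ ← t` of type `A_t`.
The vertices `1, …, t` are numbered `0, …, t - 1`, that is, by `Fin t`. -/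

namespace TypeA

/-- The target vertex `i` of the arrow `i + 1 ⟶ i`. -/
abbrev lo {t : ℕ} (i : Fin (t - 1)) : Fin t := ⟨i, by omega⟩

/-- The source vertex `i + 1` of the arrow `i + 1 ⟶ i`. -/
abbrev hi {t : ℕ} (i : Fin (t - 1)) : Fin t := ⟨i + 1, by omega⟩

/-- The representation space `R(Q, d)`: a point is a family of matrices
`A i : k ^ (d (i + 1)) → k ^ (d i)`, of size `d i × d (i + 1)`. -/
def Rep (k : Type*) {t : ℕ} (d : Fin t → ℕ) : Type _ :=
  ∀ i : Fin (t - 1), Matrix (Fin (d (lo i))) (Fin (d (hi i))) k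

/-- Index set of the matrix entries, i.e. of the coordinates of `R(Q, d)`. -/
abbrev Coord {t : ℕ} (d : Fin t → ℕ) : Type :=
  Σ i : Fin (t - 1), Fin (d (lo i)) × Fin (d (hi i))

/-- The coordinates (all the matrix entries) of a representation. -/
def Rep.coords {k : Type*} {t : ℕ} {d : Fin t → ℕ} (A : Rep k d) : Coord d → k :=
  fun c => A c.1 c.2.1 c.2.2

/-- The common zero set in `R(Q, d)` of a set of polynomials in the matrix entries. -/
def Rep.zeroSet {k : Type*} [Field k] {t : ℕ} {d : Fin t → ℕ}
    (P : Set (MvPolynomial (Coord d) k)) : Set (Rep k d) :=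
  {A | ∀ p ∈ P, MvPolynomial.eval A.coords p = 0}

theorem Rep.zeroSet_sInter {k : Type*} [Field k] {t : ℕ} {d : Fin t → ℕ}
    (T : Set (Set (Rep k d))) (hT : T ⊆ Set.range Rep.zeroSet) :
    ⋂₀ T ∈ Set.range (Rep.zeroSet (k := k) (d := d)) := by
  refine ⟨{p | ∃ S ∈ T, ∀ A ∈ S, MvPolynomial.eval A.coords p = 0}, ?_⟩
  ext A
  constructor
  · intro h S hS
    obtain ⟨P, rfl⟩ := hT hS
    exact fun p hp => h p ⟨_, hS, fun B hB => hB p hp⟩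
  · rintro h p ⟨S, hS, hp⟩
    exact hp A (h S hS)

theorem Rep.zeroSet_union {k : Type*} [Field k] {t : ℕ} {d : Fin t → ℕ}
    (P Q : Set (MvPolynomial (Coord d) k)) :
    Rep.zeroSet P ∪ Rep.zeroSet Q ∈ Set.range (Rep.zeroSet (k := k) (d := d)) := by
  refine ⟨{f | ∃ p ∈ P, ∃ q ∈ Q, f = p * q}, ?_⟩
  ext A
  constructor
  · intro h
    by_contra hcon
    rw [Set.mem_union, not_or] at hcon
    obtain ⟨h1, h2⟩ := hcon
    obtain ⟨p, hp, hp0⟩ : ∃ p ∈ P, MvPolynomial.eval A.coords p ≠ 0 := by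
      by_contra! hc
      exact h1 hc
    obtain ⟨q, hq, hq0⟩ : ∃ q ∈ Q, MvPolynomial.eval A.coords q ≠ 0 := by
      by_contra! hc
      exact h2 hc
    have := h (p * q) ⟨p, hp, q, hq, rfl⟩
    rw [map_mul] at this
    exact mul_ne_zero hp0 hq0 this
  · rintro (h | h) f ⟨p, hp, q, hq, rfl⟩
    · rw [map_mul, h p hp, zero_mul]
    · rw [map_mul, h q hq, mul_zero]

/-- The Zariski topology on the affine space `R(Q, d)`: the closed sets are the common zero sets
of polynomials in the matrix entries. -/
instance Rep.zariskiTopology (k : Type*) [Field k] {t : ℕ} (d : Fin t → ℕ) :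
    TopologicalSpace (Rep k d) :=
  TopologicalSpace.ofClosed (Set.range Rep.zeroSet)
    ⟨Set.univ, Set.eq_empty_of_forall_notMem fun A h =>
      one_ne_zero ((map_one (MvPolynomial.eval A.coords)).symm.trans (h 1 (Set.mem_univ _)))⟩
    Rep.zeroSet_sInter
    (by
      rintro _ ⟨P, rfl⟩ _ ⟨Q, rfl⟩
      exact Rep.zeroSet_union P Q)

/-- The composed map `A_(i, i + m) = A i * A (i + 1) * ⋯ * A (i + m - 1)`, a matrix of size
`d i × d (i + m)`. -/
def Rep.comp {k : Type*} [Field k] {t : ℕ} {d : Fin t → ℕ} (A : Rep k d) (i : Fin t) :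
    (m : ℕ) → (h : i + m < t) → Matrix (Fin (d i)) (Fin (d ⟨i + m, h⟩)) k
  | 0, _ => (1 : Matrix (Fin (d i)) (Fin (d i)) k)
  | m + 1, h => A.comp i m (Nat.lt_of_succ_lt h) * A ⟨i + m, Nat.lt_sub_of_add_lt h⟩

/-- `r_{i,j} = min {d_l | i ≤ l ≤ j}`. -/
def genericRank {t : ℕ} (d : Fin t → ℕ) (i j : Fin t) (h : i ≤ j) : ℕ :=
  (Finset.Icc i j).inf' (Finset.nonempty_Icc.mpr h) d

/-- The generic orbit `O(d)`: all the composed maps `A_(i, j)`, for vertices `i < j`, have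
rank `r_{i,j}`. -/
def genericOrbit (k : Type*) [Field k] {t : ℕ} (d : Fin t → ℕ) : Set (Rep k d) :=
  {A | ∀ (i : Fin t) (m : ℕ) (h : i + m < t), 0 < m →
    (A.comp i m h).rank =
      genericRank d i ⟨i + m, h⟩ (Fin.mk_le_mk.mpr (Nat.le_add_right _ _))}

/-- The complement `Y` of the generic orbit in `R(Q, d)`. -/
def complementY (k : Type*) [Field k] {t : ℕ} (d : Fin t → ℕ) : Set (Rep k d) :=
  (genericOrbit k d)ᶜ

/-- The irreducible components of a subset `Y` of a topological space, as subsets of the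
ambient space: the maximal irreducible subsets of `Y`. -/
def components {X : Type*} [TopologicalSpace X] (Y : Set X) : Set (Set X) :=
  {Z | Maximal (fun W : Set X => IsIrreducible W ∧ W ⊆ Y) Z}

/-- The codimension in the affine space `R(Q, d)` of an irreducible subset `Z`: the height of
the prime ideal of all polynomials in the matrix entries that vanish on `Z`. -/
noncomputable def codim {k : Type*} [Field k] {t : ℕ} {d : Fin t → ℕ} (Z : Set (Rep k d)) : ℕ∞ :=
  (MvPolynomial.vanishingIdeal k (Rep.coords '' Z)).height

/-- Segments `[i, j]` with `i ≤ j` vertices. -/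
abbrev Segment (t : ℕ) : Type := {s : Fin t × Fin t // s.1 ≤ s.2}

/-- A multisegment `⊕ [i, j] ^ a_{i,j}`, given by its multiplicities `a_{i,j}`. -/
abbrev Multisegment (t : ℕ) : Type := Segment t → ℕ

/-- `[i, j]` is a connected component of row `r` of the diagram that has `d l` vertices (in the
rows `1, …, d l`) in each column `l`, where neighbours in the same row are connected. -/
def IsRowComponent {t : ℕ} (d : Fin t → ℕ) (r : ℕ) (s : Segment t) : Prop :=
  (∀ l : Fin t, s.1.1 ≤ l → l ≤ s.1.2 → r ≤ d l) ∧
    (∀ l : Fin t, (l : ℕ) + 1 = s.1.1 → d l < r) ∧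
    (∀ l : Fin t, (l : ℕ) = s.1.2 + 1 → d l < r)

/-- The multisegment `M(d)` of the generic orbit: the multiplicity of `[i, j]` is the number of
rows `r ≥ 1` of the diagram of `d` in which `[i, j]` is a connected component. -/
noncomputable def genericMultisegment {t : ℕ} (d : Fin t → ℕ) : Multisegment t := fun s =>
  Nat.card {r : ℕ // 1 ≤ r ∧ IsRowComponent d r s}

/-- `d` is generic if `M(d)` contains precisely `t` pairwise different segments. -/
def IsGeneric {t : ℕ} (d : Fin t → ℕ) : Prop :=
  {s : Segment t | 0 < genericMultisegment d s}.ncard = t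

end TypeA

/-! Genericity turns into a condition on `d` alone. Each segment occurring in `M(d)` is determined
by its leftmost minimal column, so there are at most `t` of them. If there are exactly `t`, every
column arises this way, which forces `IsSeparated d` (`IsGeneric.isSeparated`).

For separated `d`, call `q` visible from `l` if it is the nearest column on its side with a smaller
entry, and let the parent of `l` be the visible column with the larger entry. Every column but the
unique minimum `ρ` has exactly one parent, which yields `t - 1` pairs `(l, p)`. To each belongs the
locus where the map between `l` and `p` has rank below `d p`. These loci are the components.

They cover `Y`: maximal rank for parent pairs propagates to all visible pairs, then along chains of
visible steps to every interval whose minimum is at an end. An arbitrary interval splits at its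
minimum into an injective and a surjective piece, so its rank is generic (`complementY_eq_iUnion`).

Each locus is irreducible: points whose maps on either side of one chosen arrow have suitable
one-sided inverses are joined by polynomial curves inside the locus, and every point moves along a
line to such a point (`isIrreducible_rankLocus_left`, `isIrreducible_rankLocus_right`).

No locus contains another: diagonal representations with one arrow deleted in one row separate them
(`not_degeneracyLocus_subset`).

The codimension is at least 2 because two minors vanish on the locus and take independent values on
a plane of representations, so the prime ideal cannot be principal (`two_le_codim_of_family`). -/

namespace TypeA

/-! ### One-sided inverses, kernels and rank factorizations -/

section LinearAlgebra

variable {k : Type*} [Field k]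

theorem exists_mul_eq_one_of_rank_eq {a b : ℕ} (M : Matrix (Fin a) (Fin b) k) (h : M.rank = a) :
    ∃ N : Matrix (Fin b) (Fin a) k, M * N = 1 := by
  rw [← Matrix.mulVec_surjective_iff_exists_right_inverse]
  have : LinearMap.range M.mulVecLin = ⊤ := by
    apply Submodule.eq_top_of_finrank_eq
    rw [Module.finrank_fin_fun]
    exact h
  exact LinearMap.range_eq_top.mp this

theorem rank_eq_of_mul_eq_one {a b : ℕ} (M : Matrix (Fin a) (Fin b) k)
    (N : Matrix (Fin b) (Fin a) k) (h : M * N = 1) : M.rank = a := by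
  apply le_antisymm (Matrix.rank_le_height M)
  have := Matrix.rank_mul_le_left M N
  rwa [h, Matrix.rank_one, Fintype.card_fin] at this

theorem rank_eq_height_iff {a b : ℕ} (M : Matrix (Fin a) (Fin b) k) :
    M.rank = a ↔ ∃ N : Matrix (Fin b) (Fin a) k, M * N = 1 :=
  ⟨exists_mul_eq_one_of_rank_eq M, fun ⟨N, h⟩ => rank_eq_of_mul_eq_one M N h⟩

theorem rank_eq_width_iff {a b : ℕ} (M : Matrix (Fin a) (Fin b) k) :
    M.rank = b ↔ ∃ N : Matrix (Fin b) (Fin a) k, N * M = 1 := by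
  rw [← Matrix.rank_transpose, rank_eq_height_iff]
  constructor
  · rintro ⟨N, h⟩
    exact ⟨N.transpose, by rw [← Matrix.transpose_inj, Matrix.transpose_mul,
      Matrix.transpose_transpose, h, Matrix.transpose_one]⟩
  · rintro ⟨N, h⟩
    exact ⟨N.transpose, by rw [← Matrix.transpose_mul, h, Matrix.transpose_one]⟩

theorem exists_vecMul_eq_zero_of_rank_lt {a b : ℕ} (M : Matrix (Fin a) (Fin b) k)
    (h : M.rank < a) : ∃ w : Fin a → k, w ≠ 0 ∧ Matrix.vecMul w M = 0 := by
  by_contra! hc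
  have : LinearMap.ker M.transpose.mulVecLin = ⊥ := by
    rw [LinearMap.ker_eq_bot']
    intro w hw
    by_contra hne
    exact hc w hne (by rwa [Matrix.mulVecLin_apply, Matrix.mulVec_transpose] at hw)
  have h2 := LinearMap.finrank_range_add_finrank_ker M.transpose.mulVecLin
  rw [this, finrank_bot, Module.finrank_fin_fun] at h2
  have h3 : M.transpose.rank = a := h2
  rw [Matrix.rank_transpose] at h3
  omega

theorem exists_mulVec_eq_zero_of_rank_lt {a b : ℕ} (M : Matrix (Fin a) (Fin b) k)
    (h : M.rank < b) : ∃ w : Fin b → k, w ≠ 0 ∧ Matrix.mulVec M w = 0 := by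
  obtain ⟨w, hw, h0⟩ := exists_vecMul_eq_zero_of_rank_lt M.transpose
    (by rwa [Matrix.rank_transpose])
  exact ⟨w, hw, by rwa [Matrix.vecMul_transpose] at h0⟩

theorem rank_lt_of_vecMul_eq_zero {a b : ℕ} (M : Matrix (Fin a) (Fin b) k) (w : Fin a → k)
    (hw : w ≠ 0) (h : Matrix.vecMul w M = 0) : M.rank < a := by
  apply lt_of_le_of_ne (Matrix.rank_le_height M)
  intro hr
  obtain ⟨N, hN⟩ := exists_mul_eq_one_of_rank_eq M hr
  apply hw
  rw [← Matrix.vecMul_one w, ← hN, ← Matrix.vecMul_vecMul, h, Matrix.zero_vecMul]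

theorem rank_lt_of_mulVec_eq_zero {a b : ℕ} (M : Matrix (Fin a) (Fin b) k) (w : Fin b → k)
    (hw : w ≠ 0) (h : Matrix.mulVec M w = 0) : M.rank < b := by
  rw [← Matrix.rank_transpose]
  exact rank_lt_of_vecMul_eq_zero _ w hw (by rwa [Matrix.vecMul_transpose])

/-- The range embeds in `k ^ r` with a retraction. The inner size is the bound `r`, not the rank
itself, so factorizations of two matrices can be interpolated factor by factor without exceeding
rank `r`. -/
theorem exists_mul_eq_of_rank_le {a b r : ℕ} (M : Matrix (Fin a) (Fin b) k) (h : M.rank ≤ r) :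
    ∃ (U : Matrix (Fin a) (Fin r) k) (V : Matrix (Fin r) (Fin b) k), U * V = M := by
  let f := M.mulVecLin
  have h' : Module.finrank k (LinearMap.range f) ≤ Module.finrank k (Fin r → k) := by
    rw [Module.finrank_fin_fun]; exact h
  obtain ⟨g, hg⟩ := finrank_le_iff_exists_linearMap.mp h'
  obtain ⟨s, hs⟩ := LinearMap.exists_leftInverse_of_injective g (LinearMap.ker_eq_bot.mpr hg)
  refine ⟨LinearMap.toMatrix' ((LinearMap.range f).subtype ∘ₗ s),
    LinearMap.toMatrix' (g ∘ₗ f.rangeRestrict), ?_⟩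
  rw [← LinearMap.toMatrix'_comp]
  have : ((LinearMap.range f).subtype ∘ₗ s) ∘ₗ (g ∘ₗ f.rangeRestrict) = f := by
    ext1 x
    have := LinearMap.congr_fun hs (f.rangeRestrict (LinearMap.single k _ x 1))
    ext y
    simpa using congrArg (fun z : LinearMap.range f => (z : Fin a → k) y) this
  rw [this]
  exact LinearMap.toMatrix'_toLin' M

/-- The kernel of the functional `x` has dimension at least `c - 1 ≥ b`, so `k ^ b` embeds in it.
The case `x = 0` is included. -/
theorem exists_vecMul_eq_zero_and_mul_eq_one {b c : ℕ} (hbc : b < c) (x : Fin c → k) :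
    ∃ (M : Matrix (Fin c) (Fin b) k) (P : Matrix (Fin b) (Fin c) k),
      Matrix.vecMul x M = 0 ∧ P * M = 1 := by
  let f : (Fin c → k) →ₗ[k] k := dotProductBilin k k x
  have h1 : Module.finrank k (Fin b → k) ≤ Module.finrank k (LinearMap.ker f) := by
    have h2 := LinearMap.finrank_range_add_finrank_ker f
    have h3 := Submodule.finrank_le (LinearMap.range f)
    rw [Module.finrank_self] at h3
    rw [Module.finrank_fin_fun] at h2 ⊢
    omega
  obtain ⟨g, hg⟩ := finrank_le_iff_exists_linearMap.mp h1
  let g' := (LinearMap.ker f).subtype ∘ₗ g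
  have hg' : Function.Injective g' := Subtype.val_injective.comp hg
  obtain ⟨s, hs⟩ := LinearMap.exists_leftInverse_of_injective g' (LinearMap.ker_eq_bot.mpr hg')
  refine ⟨LinearMap.toMatrix' g', LinearMap.toMatrix' s, ?_, ?_⟩
  · ext j
    have h3 : ∑ i, x i * (g (Pi.single j 1) : Fin c → k) i = 0 :=
      LinearMap.mem_ker.mp (g (Pi.single j 1)).2
    simpa [Matrix.vecMul, g', LinearMap.toMatrix'_apply, dotProduct] using h3
  · rw [← LinearMap.toMatrix'_comp, hs, LinearMap.toMatrix'_id]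

theorem exists_mulVec_eq_zero_and_mul_eq_one {b c : ℕ} (hbc : b < c) (x : Fin c → k) :
    ∃ (M : Matrix (Fin b) (Fin c) k) (P : Matrix (Fin c) (Fin b) k),
      Matrix.mulVec M x = 0 ∧ M * P = 1 := by
  obtain ⟨M, P, h1, h2⟩ := exists_vecMul_eq_zero_and_mul_eq_one hbc x
  refine ⟨M.transpose, P.transpose, by rwa [Matrix.mulVec_transpose], ?_⟩
  rw [← Matrix.transpose_mul, h2, Matrix.transpose_one]

end LinearAlgebra

/-! ### Matrices of functions, and polynomial functions in one variable -/

section PolynomialFunctions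

variable {k : Type*} [Field k] {X : Type*} (S : Subalgebra k (X → k))

/-- A family of matrices all of whose entries lie in a given algebra of functions. -/
def IsMatIn {m n : Type*} (M : X → Matrix m n k) : Prop := ∀ a b, (fun x => M x a b) ∈ S

variable {S}

theorem isMatIn_const {m n : Type*} (M : Matrix m n k) : IsMatIn S (fun _ => M) :=
  fun a b => S.algebraMap_mem (M a b)

theorem IsMatIn.add {m n : Type*} {M N : X → Matrix m n k} (hM : IsMatIn S M) (hN : IsMatIn S N) :
    IsMatIn S (fun x => M x + N x) :=
  fun a b => S.add_mem (hM a b) (hN a b)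

theorem IsMatIn.sub {m n : Type*} {M N : X → Matrix m n k} (hM : IsMatIn S M) (hN : IsMatIn S N) :
    IsMatIn S (fun x => M x - N x) :=
  fun a b => S.sub_mem (hM a b) (hN a b)

theorem IsMatIn.smul {m n : Type*} {f : X → k} {M : X → Matrix m n k} (hf : f ∈ S)
    (hM : IsMatIn S M) : IsMatIn S (fun x => f x • M x) :=
  fun a b => S.mul_mem hf (hM a b)

theorem IsMatIn.mul {l m n : Type*} [Fintype m] {M : X → Matrix l m k} {N : X → Matrix m n k}
    (hM : IsMatIn S M) (hN : IsMatIn S N) : IsMatIn S (fun x => M x * N x) := by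
  intro a b
  have : (fun x => (M x * N x) a b) = ∑ c, (fun x => M x a c) * (fun x => N x c b) := by
    ext x
    simp [Matrix.mul_apply]
  rw [this]
  exact S.sum_mem fun c _ => S.mul_mem (hM a c) (hN c b)

theorem IsMatIn.det {n : Type*} [Fintype n] [DecidableEq n] {M : X → Matrix n n k}
    (hM : IsMatIn S M) : (fun x => (M x).det) ∈ S := by
  have : (fun x => (M x).det) = ∑ σ : Equiv.Perm n, Equiv.Perm.sign σ •
      ∏ i, (fun x => M x (σ i) i) := by
    ext x
    simp [Matrix.det_apply]
  rw [this]
  refine S.sum_mem fun σ _ => ?_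
  rw [Units.smul_def]
  exact S.zsmul_mem (S.prod_mem fun i _ => hM _ _) _

theorem IsMatIn.adjugate {n : Type*} [Fintype n] [DecidableEq n] {M : X → Matrix n n k}
    (hM : IsMatIn S M) : IsMatIn S (fun x => (M x).adjugate) := by
  intro a b
  simp only [Matrix.adjugate_apply]
  refine IsMatIn.det fun c e => ?_
  simp only [Matrix.updateRow_apply]
  split_ifs
  · exact S.algebraMap_mem ((Pi.single a 1 : n → k) e)
  · exact hM c e

/-- The affine interpolation between two matrices. -/
theorem IsMatIn.line {m n : Type*} {f : X → k} (hf : f ∈ S) (M N : Matrix m n k) :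
    IsMatIn S (fun x => (1 - f x) • M + f x • N) :=
  (IsMatIn.smul (S.sub_mem S.one_mem hf) (isMatIn_const M)).add (IsMatIn.smul hf (isMatIn_const N))

variable (k) in
/-- The polynomial functions in one variable. -/
noncomputable def polyFun : Subalgebra k (k → k) :=
  (Polynomial.aeval (R := k) (fun s : k => s)).range

theorem mem_polyFun {f : k → k} : f ∈ polyFun k ↔ ∃ p : Polynomial k, ∀ s, p.eval s = f s := by
  have key : ∀ p : Polynomial k, ∀ s,
      Polynomial.aeval (R := k) (fun s : k => s) p s = p.eval s := by
    intro p s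
    have := Polynomial.aeval_algHom_apply (Pi.evalAlgHom k (fun _ : k => k) s) (fun s : k => s) p
    rw [Pi.evalAlgHom_apply, Pi.evalAlgHom_apply] at this
    rw [← this, Polynomial.coe_aeval_eq_eval]
  constructor
  · rintro ⟨p, hp⟩
    exact ⟨p, fun s => by rw [← key, ← hp]; rfl⟩
  · rintro ⟨p, hp⟩
    exact ⟨p, by ext s; rw [← hp, ← key]; rfl⟩

theorem id_mem_polyFun : (fun s : k => s) ∈ polyFun k :=
  mem_polyFun.mpr ⟨Polynomial.X, fun s => by simp⟩

theorem exists_mul_ne_zero_of_mem_polyFun [Infinite k] {f g : k → k} (hf : f ∈ polyFun k)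
    (hg : g ∈ polyFun k) {a b : k} (ha : f a ≠ 0) (hb : g b ≠ 0) : ∃ s, f s ≠ 0 ∧ g s ≠ 0 := by
  obtain ⟨p, hp⟩ := mem_polyFun.mp hf
  obtain ⟨q, hq⟩ := mem_polyFun.mp hg
  by_contra! hc
  have : p * q = 0 := by
    apply Polynomial.funext
    intro s
    rw [Polynomial.eval_mul, Polynomial.eval_zero, hp, hq]
    by_cases h : f s = 0
    · rw [h, zero_mul]
    · rw [hc s h, mul_zero]
  rcases mul_eq_zero.mp this with h | h
  · exact ha (by rw [← hp, h, Polynomial.eval_zero])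
  · exact hb (by rw [← hq, h, Polynomial.eval_zero])

end PolynomialFunctions

end TypeA

/-! ### Composed maps indexed by their two end vertices -/

namespace TypeA

variable {k : Type*} [Field k] {t : ℕ} {d : Fin t → ℕ}

theorem lo_lt_hi (m : Fin (t - 1)) : lo m < hi m := Nat.lt_succ_self _

theorem lt_hi_iff {m : Fin (t - 1)} {i : Fin t} : i < hi m ↔ i ≤ lo m := Nat.lt_succ_iff

theorem lo_lt_iff {m : Fin (t - 1)} {i : Fin t} : lo m < i ↔ hi m ≤ i := Nat.lt_iff_add_one_le

theorem exists_hi_eq {i j : Fin t} (h : i < j) : ∃ m : Fin (t - 1), hi m = j := by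
  have : (i : ℕ) < j := h
  refine ⟨⟨j - 1, by omega⟩, Fin.ext ?_⟩
  simp only
  omega

theorem exists_lo_eq {i j : Fin t} (h : i < j) : ∃ m : Fin (t - 1), lo m = i := by
  have : (i : ℕ) < j := h
  exact ⟨⟨i, by omega⟩, rfl⟩

theorem up_induction {P : Fin t → Prop} {i j : Fin t} (hij : i ≤ j) (base : P i)
    (step : ∀ m : Fin (t - 1), i ≤ lo m → hi m ≤ j → P (lo m) → P (hi m)) : P j := by
  have key : ∀ n : ℕ, ∀ l : Fin t, (l : ℕ) = i + n → l ≤ j → P l := by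
    intro n
    induction n with
    | zero =>
      intro l hl _
      rwa [show l = i from Fin.ext hl]
    | succ n ih =>
      intro l hl hlj
      obtain ⟨m, rfl⟩ := exists_hi_eq (show i < l by rw [Fin.lt_def]; omega)
      have h : (m : ℕ) = i + n := by
        have : (m : ℕ) + 1 = i + (n + 1) := hl
        omega
      have hle : i ≤ lo m := by rw [Fin.le_def]; simp only; omega
      exact step m hle hlj (ih (lo m) h ((lo_lt_hi m).le.trans hlj))
  exact key (j - i) j (by have : (i : ℕ) ≤ j := hij; omega) le_rfl

theorem down_induction {P : Fin t → Prop} {i j : Fin t} (hij : i ≤ j) (base : P j)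
    (step : ∀ m : Fin (t - 1), i ≤ lo m → hi m ≤ j → P (hi m) → P (lo m)) : P i := by
  have := up_induction (P := fun l => P l → P i) hij id
    (fun m h1 h2 h3 h4 => h3 (step m h1 h2 h4))
  exact this base

/-- The composed map `A_(i, j) : k ^ (d j) → k ^ (d i)` along the path from `j` to `i`. -/
def Rep.path (A : Rep k d) (i j : Fin t) : Matrix (Fin (d i)) (Fin (d j)) k := fun x y =>
  if h : i ≤ j then
    A.comp i (j - i) (by have : (i : ℕ) ≤ j := h; omega) x
      (Fin.cast (by congr 1; apply Fin.ext; have : (i : ℕ) ≤ j := h; simp; omega) y)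
  else 0

theorem Rep.comp_eq_path (A : Rep k d) (i : Fin t) (n : ℕ) (h : i + n < t) :
    A.comp i n h = A.path i ⟨i + n, h⟩ := by
  have key : ∀ (n' : ℕ) (h' : i + n' < t) (_ : n' = n) (e : d ⟨i + n, h⟩ = d ⟨i + n', h'⟩)
      (x : Fin (d i)) (y : Fin (d ⟨i + n, h⟩)),
      A.comp i n h x y = A.comp i n' h' x (Fin.cast e y) := by
    rintro n' h' rfl e x y
    rfl
  ext x y
  rw [Rep.path, dif_pos (by rw [Fin.le_def]; simp)]
  exact key _ _ (by simp) _ x y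

theorem Rep.path_self (A : Rep k d) (i : Fin t) : A.path i i = 1 :=
  (A.comp_eq_path i 0 i.2).symm

theorem Rep.path_hi (A : Rep k d) (i : Fin t) (m : Fin (t - 1)) (h : i ≤ lo m) :
    A.path i (hi m) = A.path i (lo m) * A m := by
  obtain ⟨m, hm⟩ := m
  obtain ⟨n, rfl⟩ := Nat.exists_eq_add_of_le (show (i : ℕ) ≤ m from h)
  have h1 := A.comp_eq_path i (n + 1) (by omega)
  rw [Rep.comp, A.comp_eq_path] at h1
  exact h1.symm

theorem Rep.path_trans (A : Rep k d) {i p j : Fin t} (hip : i ≤ p) (hpj : p ≤ j) :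
    A.path i p * A.path p j = A.path i j := by
  refine up_induction (P := fun j => A.path i p * A.path p j = A.path i j) hpj ?_ ?_
  · rw [A.path_self, Matrix.mul_one]
  · intro m h1 _ h2
    rw [A.path_hi p m h1, A.path_hi i m (hip.trans h1), ← h2, Matrix.mul_assoc]

theorem Rep.path_arrow (A : Rep k d) (m : Fin (t - 1)) : A.path (lo m) (hi m) = A m := by
  rw [A.path_hi _ _ le_rfl, A.path_self, Matrix.one_mul]

theorem Rep.path_lo (A : Rep k d) (j : Fin t) (m : Fin (t - 1)) (h : hi m ≤ j) :
    A.path (lo m) j = A m * A.path (hi m) j := by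
  rw [← A.path_arrow m, A.path_trans (lo_lt_hi m).le h]

theorem Rep.path_through (A : Rep k d) {i j : Fin t} (m : Fin (t - 1)) (h1 : i ≤ lo m)
    (h2 : hi m ≤ j) : A.path i j = A.path i (lo m) * A m * A.path (hi m) j := by
  rw [← A.path_hi i m h1, A.path_trans (h1.trans (lo_lt_hi m).le) h2]

theorem Rep.path_congr (A B : Rep k d) {i j : Fin t} (hij : i ≤ j)
    (h : ∀ m : Fin (t - 1), i ≤ lo m → hi m ≤ j → A m = B m) : A.path i j = B.path i j := by
  refine up_induction (P := fun j => A.path i j = B.path i j) hij ?_ ?_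
  · rw [A.path_self, B.path_self]
  · intro m h1 h2 h3
    rw [A.path_hi i m h1, B.path_hi i m h1, h3, h m h1 h2]

theorem Rep.rank_path_le (A : Rep k d) {i p j : Fin t} (hip : i ≤ p) (hpj : p ≤ j) :
    (A.path i j).rank ≤ d p := by
  rw [← A.path_trans hip hpj]
  exact (Matrix.rank_mul_le_left _ _).trans (Matrix.rank_le_width _)

/-- A family of representations all of whose matrix entries lie in a given algebra of functions. -/
def IsRepIn {X : Type*} (S : Subalgebra k (X → k)) (A : X → Rep k d) : Prop :=
  ∀ m, IsMatIn S (fun x => A x m)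

theorem IsRepIn.path {X : Type*} {S : Subalgebra k (X → k)} {A : X → Rep k d} (hA : IsRepIn S A)
    {i j : Fin t} (hij : i ≤ j) : IsMatIn S (fun x => (A x).path i j) := by
  refine up_induction (P := fun j => IsMatIn S (fun x => (A x).path i j)) hij ?_ ?_
  · simp only [Rep.path_self]
    exact isMatIn_const _
  · intro m h1 _ h3
    simp only [Rep.path_hi _ i m h1]
    exact h3.mul (hA m)

theorem IsRepIn.eval {X : Type*} {S : Subalgebra k (X → k)} {A : X → Rep k d} (hA : IsRepIn S A)
    (p : MvPolynomial (Coord d) k) : (fun x => MvPolynomial.eval (A x).coords p) ∈ S := by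
  induction p using MvPolynomial.induction_on with
  | C a =>
    simp only [MvPolynomial.eval_C]
    exact S.algebraMap_mem a
  | add p q hp hq =>
    simp only [map_add]
    exact S.add_mem hp hq
  | mul_X p c hp =>
    simp only [map_mul, MvPolynomial.eval_X]
    exact S.mul_mem hp (hA c.1 c.2.1 c.2.2)

/-! ### Regular functions, closed sets and an irreducibility criterion -/

variable (k d) in
/-- The regular functions on the representation space. -/
noncomputable def regFun : Subalgebra k (Rep k d → k) :=
  (MvPolynomial.aeval (R := k) (fun (c : Coord d) (A : Rep k d) => A.coords c)).range

theorem mem_regFun {f : Rep k d → k} :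
    f ∈ regFun k d ↔ ∃ p : MvPolynomial (Coord d) k, ∀ A, MvPolynomial.eval A.coords p = f A := by
  have key : ∀ (p : MvPolynomial (Coord d) k) (A : Rep k d),
      MvPolynomial.aeval (R := k) (fun (c : Coord d) (A : Rep k d) => A.coords c) p A =
        MvPolynomial.eval A.coords p := by
    intro p A
    induction p using MvPolynomial.induction_on with
    | C a => simp
    | add p q hp hq => simp [hp, hq]
    | mul_X p c hp => simp [hp]
  constructor
  · rintro ⟨p, hp⟩
    exact ⟨p, fun s => by rw [← key, ← hp]; rfl⟩
  · rintro ⟨p, hp⟩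
    exact ⟨p, by ext s; rw [← hp, ← key]; rfl⟩

theorem isRepIn_id : IsRepIn (regFun k d) (fun A => A) := fun m a b =>
  mem_regFun.mpr ⟨MvPolynomial.X ⟨m, a, b⟩, fun A => by simp [Rep.coords]⟩

theorem isClosed_iff_zeroSet {Z : Set (Rep k d)} : IsClosed Z ↔ Z ∈ Set.range Rep.zeroSet := by
  rw [← isOpen_compl_iff]
  change Zᶜᶜ ∈ _ ↔ _
  rw [compl_compl]

theorem isClosed_of_regFun {Z : Set (Rep k d)} (F : Set (Rep k d → k)) (hF : F ⊆ regFun k d)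
    (hZ : ∀ A, A ∈ Z ↔ ∀ f ∈ F, f A = 0) : IsClosed Z := by
  rw [isClosed_iff_zeroSet]
  refine ⟨{p | ∃ f ∈ F, ∀ A, MvPolynomial.eval A.coords p = f A}, ?_⟩
  ext A
  rw [hZ]
  constructor
  · intro h f hf
    obtain ⟨p, hp⟩ := mem_regFun.mp (hF hf)
    rw [← hp]
    exact h p ⟨f, hf, hp⟩
  · rintro h p ⟨f, hf, hp⟩
    rw [hp]
    exact h f hf

theorem exists_eval_ne_zero_of_isOpen {U : Set (Rep k d)} (hU : IsOpen U) {A : Rep k d}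
    (hA : A ∈ U) : ∃ p : MvPolynomial (Coord d) k, MvPolynomial.eval A.coords p ≠ 0 ∧
      ∀ B : Rep k d, MvPolynomial.eval B.coords p ≠ 0 → B ∈ U := by
  obtain ⟨P, hP⟩ := isClosed_iff_zeroSet.mp hU.isClosed_compl
  have : A ∉ Rep.zeroSet P := by
    rw [hP]
    exact fun h => h hA
  change ¬ ∀ p ∈ P, MvPolynomial.eval A.coords p = 0 at this
  push Not at this
  obtain ⟨p, hp, hne⟩ := this
  refine ⟨p, hne, fun B hB => ?_⟩
  by_contra hBU
  have hB' : B ∈ Uᶜ := hBU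
  rw [← hP] at hB'
  exact hB (hB' p hp)

/-- A nonzero polynomial on a curve has finitely many zeros. So an open set meeting `Z` also meets
`Zo`, and two open sets meeting `Zo` have a common point on a curve in `Z`. -/
theorem isIrreducible_of_curves [Infinite k] {Z Zo : Set (Rep k d)} (hne : Z.Nonempty)
    (h1 : ∀ A ∈ Z, ∃ (γ : k → Rep k d) (D : k → k), IsRepIn (polyFun k) γ ∧ D ∈ polyFun k ∧
      γ 0 = A ∧ (∃ s, D s ≠ 0) ∧ ∀ s, D s ≠ 0 → γ s ∈ Zo)
    (h2 : ∀ A ∈ Zo, ∀ B ∈ Zo, ∃ γ : k → Rep k d, IsRepIn (polyFun k) γ ∧ γ 0 = A ∧ γ 1 = B ∧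
      ∀ s, γ s ∈ Z) : IsIrreducible Z := by
  refine ⟨hne, ?_⟩
  have key : ∀ (U : Set (Rep k d)), IsOpen U → (Z ∩ U).Nonempty →
      ∃ A ∈ Zo, ∃ p : MvPolynomial (Coord d) k, MvPolynomial.eval A.coords p ≠ 0 ∧
        ∀ B : Rep k d, MvPolynomial.eval B.coords p ≠ 0 → B ∈ U := by
    rintro U hU ⟨A, hAZ, hAU⟩
    obtain ⟨p, hp, hpU⟩ := exists_eval_ne_zero_of_isOpen hU hAU
    obtain ⟨γ, D, hγ, hD, h0, ⟨s, hs⟩, hγo⟩ := h1 A hAZ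
    obtain ⟨s', h1', h2'⟩ := exists_mul_ne_zero_of_mem_polyFun (hγ.eval p) hD
      (a := 0) (b := s) (by rwa [h0]) hs
    exact ⟨γ s', hγo s' h2', p, h1', hpU⟩
  intro U V hU hV hZU hZV
  obtain ⟨A, hA, p, hp, hpU⟩ := key U hU hZU
  obtain ⟨B, hB, q, hq, hqV⟩ := key V hV hZV
  obtain ⟨γ, hγ, h0, h1, hZ⟩ := h2 A hA B hB
  obtain ⟨s, hs, hs'⟩ := exists_mul_ne_zero_of_mem_polyFun (hγ.eval p) (hγ.eval q)
    (a := 0) (b := 1) (by rwa [h0]) (by rwa [h1])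
  exact ⟨γ s, hZ s, hpU _ hs, hqV _ hs'⟩

/-! ### Irreducibility and closedness of the rank loci -/

/-- The matrix has a right inverse. -/
def HasRightInv {a b : ℕ} (M : Matrix (Fin a) (Fin b) k) : Prop :=
  ∃ N : Matrix (Fin b) (Fin a) k, M * N = 1

/-- The matrix has a left inverse. -/
def HasLeftInv {a b : ℕ} (M : Matrix (Fin a) (Fin b) k) : Prop :=
  ∃ N : Matrix (Fin b) (Fin a) k, N * M = 1

variable (k d) in
/-- The locus where the composed map `A_(i, j)` has rank less than `r`. -/
def rankLocus (i j : Fin t) (r : ℕ) : Set (Rep k d) := {A | (A.path i j).rank < r}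

theorem mem_rankLocus {i j : Fin t} {r : ℕ} {A : Rep k d} :
    A ∈ rankLocus k d i j r ↔ (A.path i j).rank < r := Iff.rfl

/-- The matrix `δ X - R adj(C R) C X B adj(L B) L + R W L`, where `δ = det(C R) det(L B)`. -/
def twist {a b p q : ℕ} (C : Matrix (Fin a) (Fin p) k) (R : Matrix (Fin p) (Fin a) k)
    (B : Matrix (Fin q) (Fin b) k) (L : Matrix (Fin b) (Fin q) k) (X : Matrix (Fin p) (Fin q) k)
    (W : Matrix (Fin a) (Fin b) k) : Matrix (Fin p) (Fin q) k :=
  ((C * R).det * (L * B).det) • X -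
    R * (C * R).adjugate * (C * X * B) * ((L * B).adjugate * L) + R * W * L

/-- After multiplication by `C` and `B` the first two terms of the twist cancel, since a matrix
times its adjugate is its determinant. Thus the middle matrix gets a prescribed product up to the
factors `C * R` and `L * B`. Adjugates, unlike inverses, keep everything polynomial. -/
theorem mul_twist_mul {a b p q : ℕ} (C : Matrix (Fin a) (Fin p) k) (R : Matrix (Fin p) (Fin a) k)
    (B : Matrix (Fin q) (Fin b) k) (L : Matrix (Fin b) (Fin q) k) (X : Matrix (Fin p) (Fin q) k)
    (W : Matrix (Fin a) (Fin b) k) : C * twist C R B L X W * B = C * R * W * (L * B) := by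
  have h1 : C * (R * (C * R).adjugate * (C * X * B) * ((L * B).adjugate * L)) * B =
      (C * R) * (C * R).adjugate * (C * X * B) * ((L * B).adjugate * (L * B)) := by
    simp only [Matrix.mul_assoc]
  rw [twist, Matrix.mul_add, Matrix.mul_sub, Matrix.add_mul, Matrix.sub_mul, h1,
    Matrix.mul_adjugate, Matrix.adjugate_mul]
  simp only [Matrix.mul_smul, Matrix.smul_mul, Matrix.one_mul, Matrix.mul_one, smul_smul,
    Matrix.mul_assoc]
  rw [mul_comm (L * B).det, sub_self, zero_add]

theorem twist_eq_self {a b p q : ℕ} (C : Matrix (Fin a) (Fin p) k) (R : Matrix (Fin p) (Fin a) k)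
    (B : Matrix (Fin q) (Fin b) k) (L : Matrix (Fin b) (Fin q) k) (X : Matrix (Fin p) (Fin q) k)
    (hR : C * R = 1) (hL : L * B = 1) : twist C R B L X (C * X * B) = X := by
  simp [twist, hR, hL, Matrix.mul_assoc]

/-- The line through two representations. -/
def Rep.line (A B : Rep k d) (s : k) : Rep k d := fun m => (1 - s) • A m + s • B m

theorem Rep.line_zero (A B : Rep k d) : A.line B 0 = A := by
  funext m
  simp [Rep.line]

theorem Rep.line_one (A B : Rep k d) : A.line B 1 = B := by
  funext m
  simp [Rep.line]

theorem isRepIn_line (A B : Rep k d) : IsRepIn (polyFun k) (A.line B) :=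
  fun _ => IsMatIn.line id_mem_polyFun _ _

/-- All matrices except the one at `m₀` move linearly. That one is corrected by `twist`, so that the
product from `i` to `j` factors through `k ^ (r - 1)` for every parameter. At the two ends the
chosen inverses are genuine and the correction disappears. -/
theorem exists_curve_in_rankLocus {i j : Fin t} {r : ℕ} (m₀ : Fin (t - 1)) (h1 : i ≤ lo m₀)
    (h2 : hi m₀ ≤ j) {A A' : Rep k d} (hA : A ∈ rankLocus k d i j r)
    (hA' : A' ∈ rankLocus k d i j r)
    (hC : HasRightInv (A.path i (lo m₀))) (hB : HasLeftInv (A.path (hi m₀) j))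
    (hC' : HasRightInv (A'.path i (lo m₀))) (hB' : HasLeftInv (A'.path (hi m₀) j)) :
    ∃ γ : k → Rep k d, IsRepIn (polyFun k) γ ∧ γ 0 = A ∧ γ 1 = A' ∧
      ∀ s, γ s ∈ rankLocus k d i j r := by
  rw [mem_rankLocus] at hA hA'
  obtain ⟨r, rfl⟩ : ∃ q, r = q + 1 := ⟨r - 1, by omega⟩
  obtain ⟨R, hR⟩ := hC
  obtain ⟨L, hL⟩ := hB
  obtain ⟨R', hR'⟩ := hC'
  obtain ⟨L', hL'⟩ := hB'
  obtain ⟨U, V, hUV⟩ := exists_mul_eq_of_rank_le (A.path i j) (Nat.lt_succ_iff.mp hA)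
  obtain ⟨U', V', hUV'⟩ := exists_mul_eq_of_rank_le (A'.path i j) (Nat.lt_succ_iff.mp hA')
  have hid := id_mem_polyFun (k := k)
  let E : k → Matrix (Fin (d (lo m₀))) (Fin (d (hi m₀))) k := fun s =>
    twist ((A.line A' s).path i (lo m₀)) ((1 - s) • R + s • R')
      ((A.line A' s).path (hi m₀) j) ((1 - s) • L + s • L') ((1 - s) • A m₀ + s • A' m₀)
      (((1 - s) • U + s • U') * ((1 - s) • V + s • V'))
  let γ : k → Rep k d := fun s => Function.update (A.line A' s) m₀ (E s)
  have hγ0 : ∀ s, γ s m₀ = E s := fun s => Function.update_self _ _ _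
  have hγ1 : ∀ s m, m ≠ m₀ → γ s m = A.line A' s m := fun s m h => Function.update_of_ne h _ _
  refine ⟨γ, ?_, ?_, ?_, ?_⟩
  · intro m
    by_cases hm : m = m₀
    · subst hm
      simp only [hγ0]
      have hl := isRepIn_line A A'
      have a1 := hl.path h1
      have a2 := IsMatIn.line hid R R'
      have a3 := hl.path h2
      have a4 := IsMatIn.line hid L L'
      have a5 := IsMatIn.line hid (A m) (A' m)
      have a6 := (IsMatIn.line hid U U').mul (IsMatIn.line hid V V')
      exact ((IsMatIn.smul ((polyFun k).mul_mem (a1.mul a2).det (a4.mul a3).det) a5).sub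
        (((a2.mul (a1.mul a2).adjugate).mul ((a1.mul a5).mul a3)).mul
          ((a4.mul a3).adjugate.mul a4))).add ((a2.mul a6).mul a4)
    · simp only [hγ1 _ m hm]
      exact isRepIn_line A A' m
  · funext m
    by_cases hm : m = m₀
    · subst hm
      rw [hγ0]
      have : A.path i (lo m) * A m * A.path (hi m) j = U * V := by rw [hUV, A.path_through m h1 h2]
      simp only [E, A.line_zero, sub_zero, one_smul, zero_smul, add_zero]
      rw [← this, twist_eq_self _ _ _ _ _ hR hL]
    · rw [hγ1 _ m hm, A.line_zero]
  · funext m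
    by_cases hm : m = m₀
    · subst hm
      rw [hγ0]
      have : A'.path i (lo m) * A' m * A'.path (hi m) j = U' * V' := by
        rw [hUV', A'.path_through m h1 h2]
      simp only [E, A.line_one, sub_self, one_smul, zero_smul, zero_add]
      rw [← this, twist_eq_self _ _ _ _ _ hR' hL']
    · rw [hγ1 _ m hm, A.line_one]
  · intro s
    rw [mem_rankLocus, Nat.lt_succ_iff, (γ s).path_through m₀ h1 h2, hγ0]
    have e1 : (γ s).path i (lo m₀) = (A.line A' s).path i (lo m₀) :=
      Rep.path_congr _ _ h1 fun m _ hm => hγ1 s m (by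
        rintro rfl
        exact (lo_lt_hi m).not_ge hm)
    have e2 : (γ s).path (hi m₀) j = (A.line A' s).path (hi m₀) j :=
      Rep.path_congr _ _ h2 fun m hm _ => hγ1 s m (by
        rintro rfl
        exact (lo_lt_hi m).not_ge hm)
    rw [e1, e2, mul_twist_mul]
    refine (Matrix.rank_mul_le_left _ _).trans ((Matrix.rank_mul_le_right _ _).trans
      ((Matrix.rank_mul_le_left _ _).trans (Matrix.rank_le_width _)))

theorem zero_mem_rankLocus {i j : Fin t} {r : ℕ} (hij : i < j) (hr : 0 < r) :
    (show Rep k d from fun _ => 0) ∈ rankLocus k d i j r := by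
  obtain ⟨m, rfl⟩ := exists_hi_eq hij
  rw [mem_rankLocus, Rep.path_hi _ _ _ (lt_hi_iff.mp hij), Matrix.mul_zero, Matrix.rank_zero]
  exact hr

theorem exists_mul_eq_one_of_det_ne_zero {a p : ℕ} (C : Matrix (Fin a) (Fin p) k)
    (R : Matrix (Fin p) (Fin a) k) (h : (C * R).det ≠ 0) : HasRightInv C :=
  ⟨R * (C * R)⁻¹, by rw [← Matrix.mul_assoc, Matrix.mul_nonsing_inv _ (isUnit_iff_ne_zero.mpr h)]⟩

theorem exists_mul_eq_one_of_det_ne_zero' {a p : ℕ} (C : Matrix (Fin p) (Fin a) k)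
    (L : Matrix (Fin a) (Fin p) k) (h : (L * C).det ≠ 0) : HasLeftInv C :=
  ⟨(L * C)⁻¹ * L, by rw [Matrix.mul_assoc, Matrix.nonsing_inv_mul _ (isUnit_iff_ne_zero.mpr h)]⟩

/-- Having one-sided inverses is an open condition along the line to `A'`: it holds wherever the
determinants of the products with the inverses for `A'` do not vanish, and these are 1 at the end of
the line. -/
theorem isIrreducible_rankLocus_of_lines [Infinite k] {i j : Fin t} {r : ℕ} (hr : 0 < r)
    (m₀ : Fin (t - 1)) (h1 : i ≤ lo m₀) (h2 : hi m₀ ≤ j)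
    (h : ∀ A ∈ rankLocus k d i j r, ∃ A' : Rep k d, (∀ s, A.line A' s ∈ rankLocus k d i j r) ∧
      (HasRightInv (A'.path i (lo m₀))) ∧ HasLeftInv (A'.path (hi m₀) j)) :
    IsIrreducible (rankLocus k d i j r) := by
  refine isIrreducible_of_curves (Zo := {A | A ∈ rankLocus k d i j r ∧
      (HasRightInv (A.path i (lo m₀))) ∧ HasLeftInv (A.path (hi m₀) j)})
    ⟨_, zero_mem_rankLocus ((h1.trans_lt (lo_lt_hi m₀)).trans_le h2) hr⟩ ?_ ?_
  · intro A hA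
    obtain ⟨A', hl, ⟨R, hR⟩, L, hL⟩ := h A hA
    have a1 := ((isRepIn_line A A').path h1).mul (isMatIn_const R)
    have a2 := (isMatIn_const L).mul ((isRepIn_line A A').path h2)
    refine ⟨A.line A', fun s => ((A.line A' s).path i (lo m₀) * R).det *
      (L * (A.line A' s).path (hi m₀) j).det, isRepIn_line _ _,
      (polyFun k).mul_mem a1.det a2.det, A.line_zero A', ⟨1, ?_⟩, fun s hs => ⟨hl s, ?_, ?_⟩⟩
    · simp [Rep.line_one, hR, hL]
    · exact exists_mul_eq_one_of_det_ne_zero _ _ (left_ne_zero_of_mul hs)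
    · exact exists_mul_eq_one_of_det_ne_zero' _ _ (right_ne_zero_of_mul hs)
  · rintro A ⟨hA, hC, hB⟩ A' ⟨hA', hC', hB'⟩
    exact exists_curve_in_rankLocus m₀ h1 h2 hA hA' hC hB hC' hB'

theorem exists_dotProduct_eq_one {c : ℕ} {x : Fin c → k} (hx : x ≠ 0) : ∃ v, x ⬝ᵥ v = 1 := by
  obtain ⟨a, ha⟩ := Function.ne_iff.mp hx
  exact ⟨Pi.single a (x a)⁻¹, by simpa using mul_inv_cancel₀ ha⟩

/-- The special arrow is the first one, so only the map from `j` to the vertex after `i` needs a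
left inverse. A row vector `w` killed by the whole path has images `x l` at each vertex, ending in
0. Any representation carrying `x` along in the same way stays in the locus, and this condition is
affine. As `d l > d j` for interior `l`, there is room for a copy of `k ^ (d j)` inside the kernel
of `x l`, which makes an injective choice possible. -/
theorem isIrreducible_rankLocus_left [Infinite k] {i j : Fin t} (hij : i < j) (hi0 : 0 < d i)
    (h : ∀ l, i < l → l < j → d j < d l) : IsIrreducible (rankLocus k d i j (d i)) := by
  obtain ⟨m₀, rfl⟩ := exists_lo_eq hij
  have hm₀ : hi m₀ ≤ j := lo_lt_iff.mp hij
  refine isIrreducible_rankLocus_of_lines hi0 m₀ le_rfl hm₀ fun A hA => ?_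
  obtain ⟨w, hw, hw0⟩ := exists_vecMul_eq_zero_of_rank_lt _ hA
  let x : ∀ l : Fin t, Fin (d l) → k := fun l => Matrix.vecMul w (A.path (lo m₀) l)
  have hxj : x j = 0 := hw0
  have hx : ∀ m, lo m₀ ≤ lo m → Matrix.vecMul (x (lo m)) (A m) = x (hi m) := by
    intro m hm
    simp only [x]
    rw [Matrix.vecMul_vecMul, A.path_hi _ _ hm]
  have hMP : ∀ l : Fin t, ∃ (M : Matrix (Fin (d l)) (Fin (d j)) k)
      (P : Matrix (Fin (d j)) (Fin (d l)) k),
      lo m₀ < l → l ≤ j → Matrix.vecMul (x l) M = 0 ∧ P * M = 1 := by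
    intro l
    by_cases hl : lo m₀ < l ∧ l < j
    · obtain ⟨M, P, hM⟩ := exists_vecMul_eq_zero_and_mul_eq_one (h l hl.1 hl.2) (x l)
      exact ⟨M, P, fun _ _ => hM⟩
    · by_cases hlj : l = j
      · subst hlj
        exact ⟨1, 1, fun _ _ => ⟨by rw [hxj, Matrix.zero_vecMul], Matrix.one_mul _⟩⟩
      · exact ⟨0, 0, fun h1 h2 => absurd ⟨h1, lt_of_le_of_ne h2 hlj⟩ hl⟩
  choose M P hMP using hMP
  have hv : ∀ l : Fin t, ∃ v : Fin (d l) → k, x l ≠ 0 → x l ⬝ᵥ v = 1 := by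
    intro l
    by_cases hl : x l = 0
    · exact ⟨0, fun h => absurd hl h⟩
    · obtain ⟨v, hv⟩ := exists_dotProduct_eq_one hl
      exact ⟨v, fun _ => hv⟩
  choose v hv using hv
  -- The first summand identifies the copies of `k ^ (d j)` in the kernels of the `x l`; the
  -- rank-one summand restores the transport of `x`. The first arrow is left unchanged.
  let A' : Rep k d := fun m => if lo m₀ < lo m ∧ hi m ≤ j then
    M (lo m) * P (hi m) + Matrix.vecMulVec (v (lo m)) (x (hi m)) else A m
  have hA' : ∀ m, lo m₀ ≤ lo m → Matrix.vecMul (x (lo m)) (A' m) = x (hi m) := by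
    intro m hm
    simp only [A']
    split_ifs with hc
    · rw [Matrix.vecMul_add, ← Matrix.vecMul_vecMul,
        (hMP (lo m) hc.1 ((lo_lt_hi m).le.trans hc.2)).1, Matrix.zero_vecMul, zero_add,
        Matrix.vecMul_vecMulVec]
      by_cases h0 : x (lo m) = 0
      · rw [← hx m hm, h0, Matrix.zero_vecMul, smul_zero]
      · rw [hv _ h0, one_smul]
    · exact hx m hm
  refine ⟨A', fun s => ?_, ⟨1, ?_⟩, ?_⟩
  · refine rank_lt_of_vecMul_eq_zero _ w hw ?_
    rw [← hxj]
    refine up_induction (P := fun l => Matrix.vecMul w ((A.line A' s).path (lo m₀) l) = x l)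
      hij.le ?_ ?_
    · simp only [x, Rep.path_self]
    · intro m hm _ ih
      rw [Rep.path_hi _ _ _ hm, ← Matrix.vecMul_vecMul, ih, Rep.line, Matrix.vecMul_add,
        Matrix.vecMul_smul, Matrix.vecMul_smul, hx m hm, hA' m hm, ← add_smul, sub_add_cancel,
        one_smul]
  · rw [Rep.path_self, Matrix.mul_one]
  · have hpath : A'.path (hi m₀) j * M j = M (hi m₀) := by
      refine down_induction (P := fun l => A'.path l j * M j = M l) hm₀ ?_ ?_
      · rw [Rep.path_self, Matrix.one_mul]
      · intro m hm hmj ih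
        have hlt : lo m₀ < lo m := (lo_lt_hi m₀).trans_le hm
        rw [Rep.path_lo _ _ _ hmj, Matrix.mul_assoc, ih]
        simp only [A']
        have := hMP (hi m) (hlt.trans (lo_lt_hi m)) hmj
        rw [if_pos ⟨hlt, hmj⟩, Matrix.add_mul, Matrix.mul_assoc, this.2, Matrix.mul_one,
          Matrix.vecMulVec_mul, this.1]
        ext a b
        simp [Matrix.vecMulVec_apply]
    have hj := (hMP j hij le_rfl).2
    have h0 := (hMP (hi m₀) (lo_lt_hi m₀) hm₀).2
    rw [← hpath, ← Matrix.mul_assoc] at h0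
    -- `P (hi m₀) * A'.path (hi m₀) j` and `M j` are square of size `d j`, so the order of the
    -- factors can be reversed.
    exact ⟨M j * P (hi m₀), by
      rw [Matrix.mul_assoc]
      exact mul_eq_one_comm.mp h0⟩

/-- Mirror image of `isIrreducible_rankLocus_left`: a column vector in the kernel is transported
from `j` down to `i`, and the special arrow is the last one. -/
theorem isIrreducible_rankLocus_right [Infinite k] {i j : Fin t} (hij : i < j) (hj0 : 0 < d j)
    (h : ∀ l, i < l → l < j → d i < d l) : IsIrreducible (rankLocus k d i j (d j)) := by
  obtain ⟨m₀, rfl⟩ := exists_hi_eq hij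
  have hm₀ : i ≤ lo m₀ := lt_hi_iff.mp hij
  refine isIrreducible_rankLocus_of_lines hj0 m₀ hm₀ le_rfl fun A hA => ?_
  obtain ⟨w, hw, hw0⟩ := exists_mulVec_eq_zero_of_rank_lt _ hA
  let x : ∀ l : Fin t, Fin (d l) → k := fun l => Matrix.mulVec (A.path l (hi m₀)) w
  have hxi : x i = 0 := hw0
  have hx : ∀ m, hi m ≤ hi m₀ → Matrix.mulVec (A m) (x (hi m)) = x (lo m) := by
    intro m hm
    simp only [x]
    rw [Matrix.mulVec_mulVec, A.path_lo _ _ hm]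
  have hMP : ∀ l : Fin t, ∃ (M : Matrix (Fin (d i)) (Fin (d l)) k)
      (P : Matrix (Fin (d l)) (Fin (d i)) k),
      i ≤ l → l < hi m₀ → Matrix.mulVec M (x l) = 0 ∧ M * P = 1 := by
    intro l
    by_cases hl : i < l ∧ l < hi m₀
    · obtain ⟨M, P, hM⟩ := exists_mulVec_eq_zero_and_mul_eq_one (h l hl.1 hl.2) (x l)
      exact ⟨M, P, fun _ _ => hM⟩
    · by_cases hli : l = i
      · subst hli
        exact ⟨1, 1, fun _ _ => ⟨by rw [hxi, Matrix.mulVec_zero], Matrix.one_mul _⟩⟩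
      · exact ⟨0, 0, fun h1 h2 => absurd ⟨lt_of_le_of_ne h1 (Ne.symm hli), h2⟩ hl⟩
  choose M P hMP using hMP
  have hv : ∀ l : Fin t, ∃ v : Fin (d l) → k, x l ≠ 0 → v ⬝ᵥ x l = 1 := by
    intro l
    by_cases hl : x l = 0
    · exact ⟨0, fun h => absurd hl h⟩
    · obtain ⟨v, hv⟩ := exists_dotProduct_eq_one hl
      exact ⟨v, fun _ => by rwa [dotProduct_comm]⟩
  choose v hv using hv
  let A' : Rep k d := fun m => if i ≤ lo m ∧ hi m < hi m₀ then
    P (lo m) * M (hi m) + Matrix.vecMulVec (x (lo m)) (v (hi m)) else A m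
  have hA' : ∀ m, hi m ≤ hi m₀ → Matrix.mulVec (A' m) (x (hi m)) = x (lo m) := by
    intro m hm
    simp only [A']
    split_ifs with hc
    · rw [Matrix.add_mulVec, ← Matrix.mulVec_mulVec,
        (hMP (hi m) (hc.1.trans (lo_lt_hi m).le) hc.2).1, Matrix.mulVec_zero, zero_add,
        Matrix.vecMulVec_mulVec]
      by_cases h0 : x (hi m) = 0
      · rw [← hx m hm, h0, Matrix.mulVec_zero, smul_zero]
      · rw [hv _ h0, MulOpposite.op_one, one_smul]
    · exact hx m hm
  refine ⟨A', fun s => ?_, ?_, ⟨1, ?_⟩⟩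
  · refine rank_lt_of_mulVec_eq_zero _ w hw ?_
    rw [← hxi]
    refine down_induction (P := fun l => Matrix.mulVec ((A.line A' s).path l (hi m₀)) w = x l)
      hij.le ?_ ?_
    · simp only [x, Rep.path_self]
    · intro m _ hm ih
      rw [Rep.path_lo _ _ _ hm, ← Matrix.mulVec_mulVec, ih, Rep.line, Matrix.add_mulVec,
        Matrix.smul_mulVec, Matrix.smul_mulVec, hx m hm, hA' m hm, ← add_smul, sub_add_cancel,
        one_smul]
  · have hpath : M i * A'.path i (lo m₀) = M (lo m₀) := by
      refine up_induction (P := fun l => M i * A'.path i l = M l) hm₀ ?_ ?_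
      · rw [Rep.path_self, Matrix.mul_one]
      · intro m hm hmj ih
        have hlt : hi m < hi m₀ := hmj.trans_lt (lo_lt_hi m₀)
        rw [Rep.path_hi _ _ _ hm, ← Matrix.mul_assoc, ih]
        simp only [A']
        have := hMP (lo m) hm ((lo_lt_hi m).trans hlt)
        rw [if_pos ⟨hm, hlt⟩, Matrix.mul_add, ← Matrix.mul_assoc, this.2, Matrix.one_mul,
          Matrix.mul_vecMulVec, this.1, Matrix.zero_vecMulVec, add_zero]
    have h0 := (hMP (lo m₀) hm₀ (lo_lt_hi m₀)).2
    rw [← hpath, Matrix.mul_assoc] at h0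
    exact ⟨P (lo m₀) * M i, by
      rw [← Matrix.mul_assoc]
      exact mul_eq_one_comm.mp h0⟩
  · rw [Rep.path_self, Matrix.mul_one]

/-- Full row rank means having a right inverse, which some `N` supplies after normalization as soon
as the determinant is nonzero. Constant matrices `N` thus replace a list of minors and give
equations for the locus. -/
theorem mem_rankLocus_left_iff {i j : Fin t} {A : Rep k d} :
    A ∈ rankLocus k d i j (d i) ↔ ∀ N : Matrix (Fin (d j)) (Fin (d i)) k,
      (A.path i j * N).det = 0 := by
  rw [mem_rankLocus, (Matrix.rank_le_height _).lt_iff_ne, Ne, rank_eq_height_iff]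
  constructor
  · intro h N
    by_contra hN
    exact h (exists_mul_eq_one_of_det_ne_zero _ N hN)
  · rintro h ⟨N, hN⟩
    have := h N
    rw [hN, Matrix.det_one] at this
    exact one_ne_zero this

theorem mem_rankLocus_right_iff {i j : Fin t} {A : Rep k d} :
    A ∈ rankLocus k d i j (d j) ↔ ∀ N : Matrix (Fin (d j)) (Fin (d i)) k,
      (N * A.path i j).det = 0 := by
  rw [mem_rankLocus, (Matrix.rank_le_width _).lt_iff_ne, Ne, rank_eq_width_iff]
  constructor
  · intro h N
    by_contra hN
    exact h (exists_mul_eq_one_of_det_ne_zero' _ N hN)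
  · rintro h ⟨N, hN⟩
    have := h N
    rw [hN, Matrix.det_one] at this
    exact one_ne_zero this

theorem det_path_mul_mem {i j : Fin t} (hij : i ≤ j) (N : Matrix (Fin (d j)) (Fin (d i)) k) :
    (fun A : Rep k d => (A.path i j * N).det) ∈ regFun k d :=
  ((isRepIn_id.path hij).mul (isMatIn_const N)).det

theorem det_mul_path_mem {i j : Fin t} (hij : i ≤ j) (N : Matrix (Fin (d j)) (Fin (d i)) k) :
    (fun A : Rep k d => (N * A.path i j).det) ∈ regFun k d :=
  ((isMatIn_const N).mul (isRepIn_id.path hij)).det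

theorem isClosed_rankLocus_left {i j : Fin t} (hij : i ≤ j) :
    IsClosed (rankLocus k d i j (d i)) := by
  refine isClosed_of_regFun (Set.range fun (N : Matrix (Fin (d j)) (Fin (d i)) k)
    (A : Rep k d) => (A.path i j * N).det) ?_ fun A => ?_
  · rintro _ ⟨N, rfl⟩
    exact det_path_mul_mem hij N
  · rw [mem_rankLocus_left_iff, Set.forall_mem_range]

theorem isClosed_rankLocus_right {i j : Fin t} (hij : i ≤ j) :
    IsClosed (rankLocus k d i j (d j)) := by
  refine isClosed_of_regFun (Set.range fun (N : Matrix (Fin (d j)) (Fin (d i)) k)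
    (A : Rep k d) => (N * A.path i j).det) ?_ fun A => ?_
  · rintro _ ⟨N, rfl⟩
    exact det_mul_path_mem hij N
  · rw [mem_rankLocus_right_iff, Set.forall_mem_range]

/-! ### Vanishing ideals and the codimension bound -/

theorem mem_vanishingIdeal_coords {Z : Set (Rep k d)} {p : MvPolynomial (Coord d) k} :
    p ∈ MvPolynomial.vanishingIdeal k (Rep.coords '' Z) ↔
      ∀ A ∈ Z, MvPolynomial.eval A.coords p = 0 := by
  rw [MvPolynomial.mem_vanishingIdeal_iff, Set.forall_mem_image]
  simp only [MvPolynomial.aeval_eq_eval]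

theorem isOpen_eval_ne_zero (p : MvPolynomial (Coord d) k) :
    IsOpen {A : Rep k d | MvPolynomial.eval A.coords p ≠ 0} := by
  rw [← isClosed_compl_iff]
  refine isClosed_of_regFun {fun A => MvPolynomial.eval A.coords p} ?_ fun A => ?_
  · rintro _ rfl
    exact mem_regFun.mpr ⟨p, fun _ => rfl⟩
  · simp

theorem isPrime_vanishingIdeal {Z : Set (Rep k d)} (hZ : IsIrreducible Z) :
    (MvPolynomial.vanishingIdeal k (Rep.coords '' Z)).IsPrime := by
  refine ⟨?_, ?_⟩
  · rw [Ideal.ne_top_iff_one, mem_vanishingIdeal_coords]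
    intro h
    obtain ⟨A, hA⟩ := hZ.1
    have := h A hA
    rw [map_one] at this
    exact one_ne_zero this
  · intro p q hpq
    rw [mem_vanishingIdeal_coords] at hpq
    by_contra! hc
    simp only [mem_vanishingIdeal_coords, not_forall] at hc
    obtain ⟨⟨A, hA, hpA⟩, B, hB, hqB⟩ := hc
    obtain ⟨C, hC, hpC, hqC⟩ := hZ.2 _ _ (isOpen_eval_ne_zero p) (isOpen_eval_ne_zero q)
      ⟨A, hA, hpA⟩ ⟨B, hB, hqB⟩
    have := hpq C hC
    rw [map_mul] at this
    exact mul_ne_zero hpC hqC this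

theorem eq_of_mul_eq_const [Infinite k] {f g : k → k} (hf : f ∈ polyFun k) (hg : g ∈ polyFun k)
    {c : k} (hc : c ≠ 0) (h : ∀ s, f s * g s = c) (a b : k) : f a = f b := by
  obtain ⟨p, hp⟩ := mem_polyFun.mp hf
  obtain ⟨q, hq⟩ := mem_polyFun.mp hg
  have hpq : p * q = Polynomial.C c := Polynomial.funext fun s => by
    rw [Polynomial.eval_mul, hp, hq, h, Polynomial.eval_C]
  have hu : IsUnit p := isUnit_of_mul_isUnit_left (y := q) (by
    rw [hpq]
    exact Polynomial.isUnit_C.mpr (isUnit_iff_ne_zero.mpr hc))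
  obtain ⟨e, -, rfl⟩ := Polynomial.isUnit_iff.mp hu
  rw [← hp, ← hp, Polynomial.eval_C, Polynomial.eval_C]

/-- On the plane `Φ` the functions `f` and `g` are the coordinates `u` and `v`, so a common divisor
restricts to a nonzero constant there. A generator of the ideal would be such a divisor, yet it
vanishes at `Φ 0 0`. -/
theorem two_le_codim_of_family [Infinite k] {Z : Set (Rep k d)} (hZ : IsIrreducible Z)
    {f g : Rep k d → k} (hf : f ∈ regFun k d) (hg : g ∈ regFun k d)
    (hfZ : ∀ A ∈ Z, f A = 0) (hgZ : ∀ A ∈ Z, g A = 0) (Φ : k → k → Rep k d)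
    (hu : ∀ v, IsRepIn (polyFun k) (fun u => Φ u v)) (hv : ∀ u, IsRepIn (polyFun k) (Φ u))
    (hΦf : ∀ u v, f (Φ u v) = u) (hΦg : ∀ u v, g (Φ u v) = v) (h0 : Φ 0 0 ∈ Z) :
    2 ≤ codim Z := by
  have hI := isPrime_vanishingIdeal hZ
  rw [codim]
  set I := MvPolynomial.vanishingIdeal k (Rep.coords '' Z) with hIdef
  obtain ⟨p, hp⟩ := mem_regFun.mp hf
  obtain ⟨q, hq⟩ := mem_regFun.mp hg
  have hpI : p ∈ I := mem_vanishingIdeal_coords.mpr fun A hA => (hp A).trans (hfZ A hA)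
  have hqI : q ∈ I := mem_vanishingIdeal_coords.mpr fun A hA => (hq A).trans (hgZ A hA)
  have hbot : I ≠ ⊥ := by
    intro h
    rw [h, Ideal.mem_bot] at hpI
    have := hΦf 1 0
    rw [← hp, hpI, map_zero] at this
    exact zero_ne_one this
  -- The polynomial ring is factorial, so a nonzero prime ideal contains a prime element. The chain
  -- `⊥ < (e) < I` then gives height 2 once `I` is not `(e)`.
  obtain ⟨e, heI, he⟩ := hI.exists_mem_prime_of_ne_bot hbot
  have hne : Ideal.span {e} ≠ I := by
    intro h
    rw [← h, Ideal.mem_span_singleton] at hpI hqI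
    obtain ⟨p', rfl⟩ := hpI
    obtain ⟨q', rfl⟩ := hqI
    let H : k → k → k := fun u v => MvPolynomial.eval (Φ u v).coords e
    have e1 : ∀ u v, H u v * MvPolynomial.eval (Φ u v).coords p' = u := fun u v => by
      rw [← map_mul, hp, hΦf]
    have e2 : ∀ u v, H u v * MvPolynomial.eval (Φ u v).coords q' = v := fun u v => by
      rw [← map_mul, hq, hΦg]
    have c1 : ∀ u, u ≠ 0 → ∀ v v', H u v = H u v' := fun u hu0 =>
      eq_of_mul_eq_const ((hv u).eval e) ((hv u).eval p') hu0 (e1 u)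
    have c2 : ∀ v, v ≠ 0 → ∀ u u', H u v = H u' v := fun v hv0 =>
      eq_of_mul_eq_const ((hu v).eval e) ((hu v).eval q') hv0 (fun u => e2 u v)
    -- Constancy in `v` needs `u ≠ 0` and constancy in `u` needs `v ≠ 0`, so the comparison goes
    -- through `H u 1`.
    have c3 : ∀ u, u ≠ 0 → H u 0 = H 0 1 := fun u hu0 => by
      rw [c1 u hu0 0 1, c2 1 one_ne_zero u 0]
    have hc : H 0 1 ≠ 0 := left_ne_zero_of_mul (by rw [e2]; exact one_ne_zero)
    have h00 : H 0 0 = 0 := mem_vanishingIdeal_coords.mp heI _ h0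
    obtain ⟨s, hs1, hs2⟩ := exists_mul_ne_zero_of_mem_polyFun
      ((polyFun k).sub_mem ((hu 0).eval e) ((polyFun k).algebraMap_mem (H 0 1)))
      (id_mem_polyFun (k := k)) (a := 0) (b := 1)
      (by
        change H 0 0 - H 0 1 ≠ 0
        rw [h00, zero_sub]
        exact neg_ne_zero.mpr hc) one_ne_zero
    exact hs1 (sub_eq_zero.mpr (c3 s hs2))
  have hprime : (Ideal.span {e}).IsPrime := (Ideal.span_singleton_prime he.ne_zero).mpr he
  have hlt : Ideal.span {e} < I :=
    lt_of_le_of_ne ((Ideal.span_singleton_le_iff_mem I).mpr heI) hne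
  have hlt0 : ⊥ < Ideal.span {e} := by
    rw [bot_lt_iff_ne_bot, Ne, Ideal.span_singleton_eq_bot]
    exact he.ne_zero
  have h1 := Ideal.height_add_one_le_of_lt_of_isPrime hlt0
  have h2 := Ideal.height_add_one_le_of_lt_of_isPrime hlt
  calc (2 : ℕ∞) = (⊥ : Ideal (MvPolynomial (Coord d) k)).height + 1 + 1 := by
        rw [Ideal.height_bot]; rfl
    _ ≤ (Ideal.span {e}).height + 1 := by gcongr
    _ ≤ I.height := h2

/-- The entries of the family of matrices `(1_{a - 1}, u, v)`: the entry `(a - 1, a - 1)` is `u`,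
the entry `(a - 1, a)` is `v` and the other entries are those of the identity. -/
def cornerEntry (a : ℕ) (u v : k) (x y : ℕ) : k :=
  if x + 1 = a then (if y = a then v else if y = x then u else 0) else if x = y then 1 else 0

/-- The matrix that selects the columns `0, …, a - 2` and `c`. -/
def selectCols (k : Type*) [Field k] (a b c : ℕ) : Matrix (Fin b) (Fin a) k := fun y x =>
  if (y : ℕ) = (if (x : ℕ) + 1 = a then c else x) then 1 else 0

/-- The selected columns form a diagonal matrix whose only entry that may differ from 1 is the last:
`u` for `c = a - 1`, `v` for `c = a`. -/
theorem det_mul_selectCols {a b c : ℕ} (hab : a < b) (ha : 0 < a) (hc : c = a ∨ c + 1 = a) (u v : k)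
    (T : Matrix (Fin a) (Fin b) k) (hT : ∀ x y, T x y = cornerEntry a u v x y) :
    (T * selectCols k a b c).det = if c = a then v else u := by
  have : T * selectCols k a b c =
      Matrix.diagonal fun x => if x = ⟨a - 1, by omega⟩ then (if c = a then v else u) else 1 := by
    ext x x'
    have hσ : (if (x' : ℕ) + 1 = a then c else x') < b := by split_ifs <;> omega
    rw [Matrix.mul_apply, Finset.sum_eq_single ⟨_, hσ⟩]
    · rw [selectCols, if_pos rfl, mul_one, hT, Matrix.diagonal_apply]
      simp only [cornerEntry, Fin.ext_iff]
      have := x.2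
      have := x'.2
      split_ifs <;> first | rfl | omega
    · intro y _ hy
      rw [selectCols, if_neg (fun h => hy (Fin.ext h)), mul_zero]
    · intro h
      exact absurd (Finset.mem_univ _) h
  rw [this, Matrix.det_diagonal, Finset.prod_ite_eq' Finset.univ]
  simp

/-- The representation whose `m`-th matrix is diagonal with entries `ε m 0, ε m 1, …`. -/
def diagRep (d : Fin t → ℕ) (ε : Fin (t - 1) → ℕ → k) : Rep k d := fun m x y =>
  if (x : ℕ) = y then ε m x else 0

theorem diagRep_path_ne_zero {ε : Fin (t - 1) → ℕ → k} {i j : Fin t} (hij : i ≤ j) :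
    ∀ (x : Fin (d i)) (y : Fin (d j)), (diagRep d ε).path i j x y ≠ 0 →
      (x : ℕ) = y ∧ ∀ m, i ≤ lo m → hi m ≤ j → ε m x ≠ 0 := by
  refine up_induction (P := fun j => ∀ (x : Fin (d i)) (y : Fin (d j)),
    (diagRep d ε).path i j x y ≠ 0 → (x : ℕ) = y ∧ ∀ m, i ≤ lo m → hi m ≤ j → ε m x ≠ 0) hij ?_ ?_
  · intro x y h
    rw [Rep.path_self, Matrix.one_apply] at h
    refine ⟨congrArg _ (not_not.mp fun hxy => h (if_neg hxy)), fun m h1 h2 => ?_⟩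
    exact absurd ((lo_lt_hi m).trans_le (h2.trans h1)) (lt_irrefl _)
  · intro m hm _ ih x y h
    rw [Rep.path_hi _ _ _ hm, Matrix.mul_apply] at h
    obtain ⟨z, -, hz⟩ := Finset.exists_ne_zero_of_sum_ne_zero h
    obtain ⟨hxz, hε⟩ := ih x z (left_ne_zero_of_mul hz)
    have hzy := right_ne_zero_of_mul hz
    rw [diagRep] at hzy
    split_ifs at hzy with hzy'
    · refine ⟨hxz.trans hzy', fun m' h1 h2 => ?_⟩
      rcases h2.lt_or_eq with h3 | h3
      · exact hε m' h1 (lt_hi_iff.mp h3)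
      · have : m' = m := Fin.ext (by simpa using congrArg Fin.val h3)
        rwa [this, hxz]
    · exact absurd rfl hzy

theorem diagRep_path_eq_one {ε : Fin (t - 1) → ℕ → k} {i j : Fin t} (hij : i ≤ j) {r : ℕ}
    (hr : ∀ l, i ≤ l → l ≤ j → r < d l) (hε : ∀ m, i ≤ lo m → hi m ≤ j → ε m r = 1) :
    ∀ (x : Fin (d i)) (y : Fin (d j)), (x : ℕ) = r → (y : ℕ) = r →
      (diagRep d ε).path i j x y = 1 := by
  refine up_induction (P := fun j' => j' ≤ j → ∀ (x : Fin (d i)) (y : Fin (d j')), (x : ℕ) = r →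
    (y : ℕ) = r → (diagRep d ε).path i j' x y = 1) hij ?_ ?_ le_rfl
  · intro _ x y hx hy
    rw [Rep.path_self, Matrix.one_apply, if_pos (Fin.ext (hx.trans hy.symm))]
  · intro m hm _ ih hmj x y hx hy
    have hlo := (lo_lt_hi m).le.trans hmj
    rw [Rep.path_hi _ _ _ hm, Matrix.mul_apply, Finset.sum_eq_single ⟨r, hr _ hm hlo⟩]
    · rw [ih hlo x _ hx rfl, diagRep, if_pos hy.symm, hε m hm hmj, one_mul]
    · intro z _ hz
      rw [diagRep, if_neg fun h => hz (Fin.ext (h.trans hy)), mul_zero]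
    · intro h
      exact absurd (Finset.mem_univ _) h

theorem diagRep_one_path_apply_right {i j : Fin t} (hij : i ≤ j) (x : Fin (d i)) (y : Fin (d j))
    (hy : ∀ l, i ≤ l → l ≤ j → (y : ℕ) < d l) :
    (diagRep d fun _ _ => (1 : k)).path i j x y = if (x : ℕ) = y then 1 else 0 := by
  split_ifs with h
  · exact diagRep_path_eq_one hij hy (fun _ _ _ => rfl) x y h rfl
  · by_contra hc
    exact h (diagRep_path_ne_zero hij x y hc).1

theorem diagRep_one_path_apply_left {i j : Fin t} (hij : i ≤ j) (x : Fin (d i)) (y : Fin (d j))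
    (hx : ∀ l, i ≤ l → l ≤ j → (x : ℕ) < d l) :
    (diagRep d fun _ _ => (1 : k)).path i j x y = if (x : ℕ) = y then 1 else 0 := by
  split_ifs with h
  · exact diagRep_path_eq_one hij hx (fun _ _ _ => rfl) x y rfl h.symm
  · by_contra hc
    exact h (diagRep_path_ne_zero hij x y hc).1

theorem cornerEntry_mem_left (a : ℕ) (v : k) (x y : ℕ) :
    (fun u => cornerEntry a u v x y) ∈ polyFun k := by
  unfold cornerEntry
  split_ifs
  exacts [(polyFun k).algebraMap_mem v, id_mem_polyFun, (polyFun k).zero_mem,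
    (polyFun k).one_mem, (polyFun k).zero_mem]

theorem cornerEntry_mem_right (a : ℕ) (u : k) (x y : ℕ) :
    (fun v => cornerEntry a u v x y) ∈ polyFun k := by
  unfold cornerEntry
  split_ifs
  exacts [id_mem_polyFun, (polyFun k).algebraMap_mem u, (polyFun k).zero_mem,
    (polyFun k).one_mem, (polyFun k).zero_mem]

/-- Replace one matrix of a representation. -/
def Rep.update {k : Type*} {t : ℕ} {d : Fin t → ℕ} (A : Rep k d) (m₀ : Fin (t - 1))
    (E : Matrix (Fin (d (lo m₀))) (Fin (d (hi m₀))) k) :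
    Rep k d :=
  Function.update A m₀ E

theorem Rep.update_self {k : Type*} {t : ℕ} {d : Fin t → ℕ} (A : Rep k d) (m₀ : Fin (t - 1))
    (E : Matrix (Fin (d (lo m₀))) (Fin (d (hi m₀))) k) : A.update m₀ E m₀ = E :=
  Function.update_self _ _ _

theorem Rep.update_of_ne {k : Type*} {t : ℕ} {d : Fin t → ℕ} (A : Rep k d) {m₀ m : Fin (t - 1)}
    (E : Matrix (Fin (d (lo m₀))) (Fin (d (hi m₀))) k) (h : m ≠ m₀) : A.update m₀ E m = A m :=
  Function.update_of_ne h _ _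

theorem isRepIn_update {S : Subalgebra k (k → k)} (A : Rep k d) (m₀ : Fin (t - 1))
    {E : k → Matrix (Fin (d (lo m₀))) (Fin (d (hi m₀))) k} (hE : IsMatIn S E) :
    IsRepIn S (fun s => A.update m₀ (E s)) := by
  intro m
  by_cases hm : m = m₀
  · subst hm
    simpa only [Rep.update_self] using hE
  · simp only [Rep.update_of_ne _ _ hm]
    exact isMatIn_const _

/-- Put the corner matrix at the first arrow and diagonal matrices elsewhere. Since `d j` is minimal
on the rest of the path, the remaining maps keep exactly the first `d j` columns. The extra column
exists because `d i < d j`, and at `u = v = 0` the last row is zero. -/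
theorem two_le_codim_rankLocus_left [Infinite k] {i j : Fin t} (hij : i < j) (hi0 : 0 < d i)
    (hd : d i < d j) (h : ∀ l, i < l → l < j → d j < d l) :
    2 ≤ codim (rankLocus k d i j (d i)) := by
  have hirr : IsIrreducible (rankLocus k d i j (d i)) := isIrreducible_rankLocus_left hij hi0 h
  obtain ⟨m₀, rfl⟩ := exists_lo_eq hij
  have hm₀ : hi m₀ ≤ j := lo_lt_iff.mp hij
  have hle : ∀ l, hi m₀ ≤ l → l ≤ j → d j ≤ d l := fun l h1 h2 => by
    rcases h2.lt_or_eq with h3 | rfl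
    · exact (h l ((lo_lt_hi m₀).trans_le h1) h3).le
    · exact le_rfl
  let Φ : k → k → Rep k d := fun u v => (diagRep d fun _ _ => (1 : k)).update m₀
    fun x y => cornerEntry (d (lo m₀)) u v x y
  have hΦ : ∀ u v x y, (Φ u v).path (lo m₀) j x y = cornerEntry (d (lo m₀)) u v x y := by
    intro u v x y
    have e1 : (Φ u v).path (hi m₀) j = (diagRep d fun _ _ => (1 : k)).path (hi m₀) j :=
      Rep.path_congr _ _ hm₀ fun m hm _ => Rep.update_of_ne _ _ (by
        rintro rfl
        exact (lo_lt_hi m).not_ge hm)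
    have hy : ∀ l, hi m₀ ≤ l → l ≤ j → (y : ℕ) < d l := fun l h1 h2 => y.2.trans_le (hle l h1 h2)
    rw [Rep.path_lo _ _ _ hm₀, e1, Matrix.mul_apply,
      Finset.sum_eq_single ⟨y, hy _ le_rfl hm₀⟩]
    · rw [diagRep_one_path_apply_right hm₀ _ _ hy, if_pos rfl, mul_one]
      exact congrFun (congrFun (Rep.update_self _ _ _) _) _
    · intro z _ hz
      rw [diagRep_one_path_apply_right hm₀ _ _ hy, if_neg fun h => hz (Fin.ext h), mul_zero]
    · intro h
      exact absurd (Finset.mem_univ _) h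
  refine two_le_codim_of_family hirr
    (det_path_mul_mem hij.le (selectCols k (d (lo m₀)) (d j) (d (lo m₀) - 1)))
    (det_path_mul_mem hij.le (selectCols k (d (lo m₀)) (d j) (d (lo m₀))))
    (fun A hA => mem_rankLocus_left_iff.mp hA _) (fun A hA => mem_rankLocus_left_iff.mp hA _)
    Φ (fun v => isRepIn_update _ _ fun x y => cornerEntry_mem_left _ _ _ _)
    (fun u => isRepIn_update _ _ fun x y => cornerEntry_mem_right _ _ _ _) ?_ ?_ ?_
  · intro u v
    rw [det_mul_selectCols hd hi0 (Or.inr (by omega)) u v _ (hΦ u v), if_neg (by omega)]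
  · intro u v
    rw [det_mul_selectCols hd hi0 (Or.inl rfl) u v _ (hΦ u v), if_pos rfl]
  · refine rank_lt_of_vecMul_eq_zero _ (Pi.single ⟨d (lo m₀) - 1, by omega⟩ 1) ?_ ?_
    · exact fun h0 => one_ne_zero ((Pi.single_eq_same _ _).symm.trans (congrFun h0 _))
    · ext y
      rw [Matrix.single_one_vecMul, Matrix.row_apply, hΦ, cornerEntry, if_pos (by simp only; omega)]
      split_ifs <;> rfl

theorem two_le_codim_rankLocus_right [Infinite k] {i j : Fin t} (hij : i < j) (hj0 : 0 < d j)
    (hd : d j < d i) (h : ∀ l, i < l → l < j → d i < d l) :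
    2 ≤ codim (rankLocus k d i j (d j)) := by
  have hirr : IsIrreducible (rankLocus k d i j (d j)) := isIrreducible_rankLocus_right hij hj0 h
  obtain ⟨m₀, rfl⟩ := exists_hi_eq hij
  have hm₀ : i ≤ lo m₀ := lt_hi_iff.mp hij
  have hle : ∀ l, i ≤ l → l ≤ lo m₀ → d i ≤ d l := fun l h1 h2 => by
    rcases h1.lt_or_eq with h3 | rfl
    · exact (h l h3 (h2.trans_lt (lo_lt_hi m₀))).le
    · exact le_rfl
  let Φ : k → k → Rep k d := fun u v => (diagRep d fun _ _ => (1 : k)).update m₀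
    fun x y => cornerEntry (d (hi m₀)) u v y x
  have hΦ : ∀ u v x y, (Φ u v).path i (hi m₀) x y = cornerEntry (d (hi m₀)) u v y x := by
    intro u v x y
    have e1 : (Φ u v).path i (lo m₀) = (diagRep d fun _ _ => (1 : k)).path i (lo m₀) :=
      Rep.path_congr _ _ hm₀ fun m _ hm => Rep.update_of_ne _ _ (by
        rintro rfl
        exact (lo_lt_hi m).not_ge hm)
    have hx : ∀ l, i ≤ l → l ≤ lo m₀ → (x : ℕ) < d l := fun l h1 h2 => x.2.trans_le (hle l h1 h2)
    rw [Rep.path_hi _ _ _ hm₀, e1, Matrix.mul_apply,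
      Finset.sum_eq_single ⟨x, hx _ hm₀ le_rfl⟩]
    · rw [diagRep_one_path_apply_left hm₀ _ _ hx, if_pos rfl, one_mul]
      exact congrFun (congrFun (Rep.update_self _ _ _) _) _
    · intro z _ hz
      rw [diagRep_one_path_apply_left hm₀ _ _ hx, if_neg fun h => hz (Fin.ext h.symm), zero_mul]
    · intro h
      exact absurd (Finset.mem_univ _) h
  have hdet : ∀ u v c, c = d (hi m₀) ∨ c + 1 = d (hi m₀) →
      ((selectCols k (d (hi m₀)) (d i) c).transpose * (Φ u v).path i (hi m₀)).det =
        if c = d (hi m₀) then v else u := by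
    intro u v c hc
    rw [← Matrix.det_transpose, Matrix.transpose_mul, Matrix.transpose_transpose]
    exact det_mul_selectCols hd hj0 hc u v _ fun x y => hΦ u v y x
  refine two_le_codim_of_family hirr
    (det_mul_path_mem hij.le (selectCols k (d (hi m₀)) (d i) (d (hi m₀) - 1)).transpose)
    (det_mul_path_mem hij.le (selectCols k (d (hi m₀)) (d i) (d (hi m₀))).transpose)
    (fun A hA => mem_rankLocus_right_iff.mp hA _) (fun A hA => mem_rankLocus_right_iff.mp hA _)
    Φ (fun v => isRepIn_update _ _ fun x y => cornerEntry_mem_left _ _ _ _)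
    (fun u => isRepIn_update _ _ fun x y => cornerEntry_mem_right _ _ _ _) ?_ ?_ ?_
  · intro u v
    rw [hdet u v _ (Or.inr (by omega)), if_neg (by omega)]
  · intro u v
    rw [hdet u v _ (Or.inl rfl), if_pos rfl]
  · refine rank_lt_of_mulVec_eq_zero _ (Pi.single ⟨d (hi m₀) - 1, by omega⟩ 1) ?_ ?_
    · exact fun h0 => one_ne_zero ((Pi.single_eq_same _ _).symm.trans (congrFun h0 _))
    · ext x
      rw [Matrix.mulVec_single_one, Matrix.col_apply, hΦ, cornerEntry, if_pos (by simp only; omega)]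
      split_ifs <;> rfl

end TypeA

namespace TypeA

/-! ### Components of a finite irredundant union -/

section Components

theorem components_eq_range {X ι : Type*} [TopologicalSpace X] [Finite ι] {Y : Set X}
    {Z : ι → Set X} (hcl : ∀ a, IsClosed (Z a)) (hirr : ∀ a, IsIrreducible (Z a))
    (hY : Y = ⋃ a, Z a) (hsub : ∀ a b, Z a ⊆ Z b → a = b) : components Y = Set.range Z := by
  have key : ∀ W : Set X, IsIrreducible W → W ⊆ Y → ∃ a, W ⊆ Z a := by
    intro W hW hWY
    obtain ⟨z, hz, hWz⟩ := isIrreducible_iff_sUnion_isClosed.mp hW (Set.finite_range Z).toFinset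
      (by simpa using hcl) (by simpa [Set.sUnion_range, ← hY] using hWY)
    rw [Set.Finite.mem_toFinset] at hz
    obtain ⟨a, rfl⟩ := hz
    exact ⟨a, hWz⟩
  have hZY : ∀ a, Z a ⊆ Y := fun a => hY ▸ Set.subset_iUnion Z a
  ext W
  constructor
  · intro (hW : Maximal (fun W : Set X => IsIrreducible W ∧ W ⊆ Y) W)
    obtain ⟨a, ha⟩ := key W hW.prop.1 hW.prop.2
    exact ⟨a, (hW.eq_of_le ⟨hirr a, hZY a⟩ ha).symm⟩
  · rintro ⟨a, rfl⟩
    refine ⟨⟨hirr a, hZY a⟩, fun W hW haW => ?_⟩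
    obtain ⟨b, hb⟩ := key W hW.1 hW.2
    obtain rfl := hsub a b (haW.trans hb)
    exact hb

end Components

/-! ### Separated dimension vectors, visibility and parents -/

section Combinatorics

variable {t : ℕ} {d : Fin t → ℕ}

/-- All entries are positive, and between two equal entries there is a smaller one. -/
def IsSeparated (d : Fin t → ℕ) : Prop :=
  (∀ l, 0 < d l) ∧ ∀ l m, l < m → d l = d m → ∃ p, l < p ∧ p < m ∧ d p < d l

theorem exists_leftmost_min (s : Segment t) (d : Fin t → ℕ) : ∃ l, s.1.1 ≤ l ∧ l ≤ s.1.2 ∧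
    (∀ x, s.1.1 ≤ x → x ≤ s.1.2 → d l ≤ d x) ∧ ∀ x, s.1.1 ≤ x → x < l → d l < d x := by
  -- The lexicographic order breaks ties among minimal entries in favour of the leftmost column.
  obtain ⟨l, hl, hmin⟩ := Finset.exists_min_image (Finset.Icc s.1.1 s.1.2)
    (fun x => toLex (d x, x)) (Finset.nonempty_Icc.mpr s.2)
  rw [Finset.mem_Icc] at hl
  have h : ∀ x, s.1.1 ≤ x → x ≤ s.1.2 → d l < d x ∨ d l = d x ∧ l ≤ x := fun x h1 h2 => by
    have := hmin x (Finset.mem_Icc.mpr ⟨h1, h2⟩)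
    rwa [Prod.Lex.toLex_le_toLex] at this
  refine ⟨l, hl.1, hl.2, fun x h1 h2 => ?_, fun x h1 h2 => ?_⟩
  · rcases h x h1 h2 with h3 | h3
    · exact h3.le
    · exact h3.1.le
  · rcases h x h1 (h2.le.trans hl.2) with h3 | h3
    · exact h3
    · exact absurd h2 h3.2.not_gt

theorem exists_isRowComponent {s : Segment t} (h : 0 < genericMultisegment d s) :
    ∃ r, 1 ≤ r ∧ IsRowComponent d r s := by
  obtain ⟨⟨r, hr⟩⟩ := (Nat.card_pos_iff.mp h).1
  exact ⟨r, hr⟩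

/-- Otherwise the column just before the segment would lie in the stretch from `l` to `m`, where row
`r` is occupied, and the component would not stop there. -/
theorem isRowComponent_fst_le {s : Segment t} {r : ℕ} (h : IsRowComponent d r s) {l m : Fin t}
    (hm : s.1.1 ≤ m) (hr : ∀ x, l ≤ x → x ≤ m → r ≤ d x) : s.1.1 ≤ l := by
  by_contra hc
  rw [not_le, Fin.lt_def] at hc
  have h1 := h.2.1 ⟨s.1.1 - 1, by omega⟩ (by simp only; omega)
  have h2 := hr ⟨s.1.1 - 1, by omega⟩ (by rw [Fin.le_def]; simp only; omega)
    (by rw [Fin.le_def] at hm ⊢; simp only; omega)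
  omega

theorem isRowComponent_le_snd {s : Segment t} {r : ℕ} (h : IsRowComponent d r s) {l m : Fin t}
    (hl : l ≤ s.1.2) (hr : ∀ x, l ≤ x → x ≤ m → r ≤ d x) : m ≤ s.1.2 := by
  by_contra hc
  rw [not_le, Fin.lt_def] at hc
  have h1 := h.2.2 ⟨s.1.2 + 1, by omega⟩ rfl
  have h2 := hr ⟨s.1.2 + 1, by omega⟩ (by rw [Fin.le_def] at hl ⊢; simp only; omega)
    (by rw [Fin.le_def]; simp only; omega)
  omega

/-- A segment is recovered from its leftmost minimum: it is the widest interval around that column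
on which the column is still minimal. Hence this assignment is injective, and by counting it is onto
all columns. -/
theorem IsGeneric.isSeparated (hd : IsGeneric d) : IsSeparated d := by
  choose μ h1 h2 h3 h4 using fun s => exists_leftmost_min s d
  have hinj : Set.InjOn μ {s : Segment t | 0 < genericMultisegment d s} := by
    intro s hs s' hs' hμ
    obtain ⟨r, -, hr⟩ := exists_isRowComponent hs
    obtain ⟨r', -, hr'⟩ := exists_isRowComponent hs'
    have hrμ : r ≤ d (μ s) := hr.1 _ (h1 s) (h2 s)
    have hrμ' : r' ≤ d (μ s) := hμ ▸ hr'.1 _ (h1 s') (h2 s')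
    have a1 : s'.1.1 ≤ s.1.1 := isRowComponent_fst_le hr' (m := μ s) (hμ ▸ h1 s')
      fun x hx hx' => hrμ'.trans (h3 s x hx (hx'.trans (h2 s)))
    have a2 : s.1.1 ≤ s'.1.1 := isRowComponent_fst_le hr (m := μ s') (hμ ▸ h1 s)
      fun x hx hx' => (hμ ▸ hrμ).trans (h3 s' x hx (hx'.trans (h2 s')))
    have a3 : s.1.2 ≤ s'.1.2 := isRowComponent_le_snd hr' (l := μ s) (hμ ▸ h2 s')
      fun x hx hx' => hrμ'.trans (h3 s x ((h1 s).trans hx) hx')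
    have a4 : s'.1.2 ≤ s.1.2 := isRowComponent_le_snd hr (l := μ s') (hμ ▸ h2 s)
      fun x hx hx' => (hμ ▸ hrμ).trans (h3 s' x ((h1 s').trans hx) hx')
    exact Subtype.ext (Prod.ext (le_antisymm a2 a1) (le_antisymm a3 a4))
  have hsurj : μ '' {s : Segment t | 0 < genericMultisegment d s} = Set.univ := by
    apply Set.eq_of_subset_of_ncard_le (Set.subset_univ _)
    rw [hinj.ncard_image, Set.ncard_univ, Nat.card_fin]
    exact hd.ge
  have hs : ∀ l, ∃ s r, 1 ≤ r ∧ IsRowComponent d r s ∧ μ s = l := by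
    intro l
    obtain ⟨s, hs, hl⟩ := hsurj.ge (Set.mem_univ l)
    obtain ⟨r, hr1, hr⟩ := exists_isRowComponent hs
    exact ⟨s, r, hr1, hr, hl⟩
  refine ⟨fun l => ?_, fun l m hlm hdlm => ?_⟩
  · obtain ⟨s, r, hr1, hr, rfl⟩ := hs l
    exact hr1.trans (hr.1 _ (h1 s) (h2 s))
  · by_contra! hc
    -- The segment with leftmost minimum `m` would extend left as far as `l`, where the same value
    -- already occurs.
    obtain ⟨s, r, -, hr, rfl⟩ := hs m
    have hrμ : r ≤ d (μ s) := hr.1 _ (h1 s) (h2 s)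
    have hle : s.1.1 ≤ l := isRowComponent_fst_le hr (h1 s) fun x hx hx' => by
      rcases hx.lt_or_eq with h5 | rfl
      · rcases hx'.lt_or_eq with h6 | rfl
        · exact hrμ.trans (hdlm.symm.le.trans (hc x h5 h6))
        · exact hrμ
      · exact hrμ.trans hdlm.ge
    exact (h4 s l hle hlm).ne' hdlm

/-- `q` is the nearest vertex, on one of the two sides of `l`, with a smaller entry. -/
def IsVisible (d : Fin t → ℕ) (l q : Fin t) : Prop :=
  d q < d l ∧ ∀ x, (l < x ∧ x < q) ∨ (q < x ∧ x < l) → d l ≤ d x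

/-- `p` is the vertex visible from `l` with the larger entry. -/
def IsParent (d : Fin t → ℕ) (l p : Fin t) : Prop :=
  IsVisible d l p ∧ ∀ q, IsVisible d l q → d q ≤ d p

theorem IsVisible.ne {l q : Fin t} (h : IsVisible d l q) : l ≠ q := by
  rintro rfl
  exact lt_irrefl _ h.1

theorem IsVisible.lt_of_between (hd : IsSeparated d) {l q : Fin t} (h : IsVisible d l q) {x : Fin t}
    (hx : (l < x ∧ x < q) ∨ (q < x ∧ x < l)) : d l < d x := by
  refine lt_of_le_of_ne (h.2 x hx) fun he => ?_
  rcases hx with ⟨h1, h2⟩ | ⟨h1, h2⟩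
  · obtain ⟨p, h3, h4, h5⟩ := hd.2 l x h1 he
    exact h5.not_ge (h.2 p (Or.inl ⟨h3, h4.trans h2⟩))
  · obtain ⟨p, h3, h4, h5⟩ := hd.2 x l h2 he.symm
    exact (h5.trans_eq he.symm).not_ge (h.2 p (Or.inr ⟨h1.trans h3, h4⟩))

theorem exists_isVisible_right {l m : Fin t} (hlm : l < m) (hd : d m < d l) :
    ∃ q, l < q ∧ q ≤ m ∧ IsVisible d l q := by
  obtain ⟨q, hq, hmin⟩ := Finset.exists_min_image (Finset.univ.filter fun q => l < q ∧ d q < d l)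
    id ⟨m, by simp [hlm, hd]⟩
  simp only [Finset.mem_filter, Finset.mem_univ, true_and, id] at hq hmin
  refine ⟨q, hq.1, hmin m ⟨hlm, hd⟩, hq.2, ?_⟩
  rintro x (⟨h1, h2⟩ | ⟨h1, h2⟩)
  · by_contra! hc
    exact h2.not_ge (hmin x ⟨h1, hc⟩)
  · exact absurd (h1.trans h2) hq.1.not_gt

theorem exists_isVisible_left {l m : Fin t} (hlm : m < l) (hd : d m < d l) :
    ∃ q, q < l ∧ m ≤ q ∧ IsVisible d l q := by
  obtain ⟨q, hq, hmax⟩ := Finset.exists_max_image (Finset.univ.filter fun q => q < l ∧ d q < d l)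
    id ⟨m, by simp [hlm, hd]⟩
  simp only [Finset.mem_filter, Finset.mem_univ, true_and, id] at hq hmax
  refine ⟨q, hq.1, hmax m ⟨hlm, hd⟩, hq.2, ?_⟩
  rintro x (⟨h1, h2⟩ | ⟨h1, h2⟩)
  · exact absurd (h1.trans h2) hq.1.not_gt
  · by_contra! hc
    exact h1.not_ge (hmax x ⟨h2, hc⟩)

theorem IsVisible.exists_isParent {l q : Fin t} (h : IsVisible d l q) : ∃ p, IsParent d l p := by
  classical
  obtain ⟨p, hp, hmax⟩ := Finset.exists_max_image (Finset.univ.filter fun q => IsVisible d l q)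
    d ⟨q, by simp [h]⟩
  simp only [Finset.mem_filter, Finset.mem_univ, true_and] at hp hmax
  exact ⟨p, hp, hmax⟩

theorem IsSeparated.exists_root (hd : IsSeparated d) (ht : 1 ≤ t) :
    ∃ ρ : Fin t, (∀ l, l ≠ ρ → ∃ p, IsParent d l p) ∧ ∀ l, d ρ ≤ d l := by
  obtain ⟨ρ, -, hρ⟩ := Finset.exists_min_image Finset.univ d
    ⟨(⟨0, ht⟩ : Fin t), Finset.mem_univ _⟩
  have hle : ∀ x, d ρ ≤ d x := fun x => hρ x (Finset.mem_univ x)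
  refine ⟨ρ, fun l hl => ?_, hle⟩
  have hlt : d ρ < d l := by
    refine lt_of_le_of_ne (hle l) fun he => ?_
    rcases lt_or_gt_of_ne hl with h | h
    · obtain ⟨p, -, -, hp⟩ := hd.2 l ρ h he.symm
      exact (hp.trans_eq he.symm).not_ge (hle p)
    · obtain ⟨p, -, -, hp⟩ := hd.2 ρ l h he
      exact hp.not_ge (hle p)
  rcases lt_or_gt_of_ne hl with h | h
  · obtain ⟨q, -, -, hq⟩ := exists_isVisible_right h hlt
    exact hq.exists_isParent
  · obtain ⟨q, -, -, hq⟩ := exists_isVisible_left h hlt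
    exact hq.exists_isParent

theorem IsVisible.opposite {l p q : Fin t} (hp : IsVisible d l p) (hq : IsVisible d l q)
    (hpq : p ≠ q) : (q < l ∧ l < p) ∨ (p < l ∧ l < q) := by
  have h1 := hp.2 q
  have h2 := hq.2 p
  have h3 := hp.1
  have h4 := hq.1
  have h5 := hp.ne
  have h6 := hq.ne
  grind

theorem IsVisible.of_opposite {l p q : Fin t} (hp : IsVisible d l p) (hq : IsVisible d l q)
    (hpq : p ≠ q) (hd : d q < d p) : IsVisible d p q := by
  refine ⟨hd, fun x hx => ?_⟩
  have h0 := hp.opposite hq hpq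
  have h1 := hp.2 x
  have h2 := hq.2 x
  have h3 := hp.1
  grind

theorem IsVisible.entry_ne (hd : IsSeparated d) {l p q : Fin t} (hp : IsVisible d l p)
    (hq : IsVisible d l q) (hpq : p ≠ q) : d p ≠ d q := by
  intro he
  have h0 := hp.opposite hq hpq
  have h3 := hp.1
  rcases lt_or_gt_of_ne hpq with h | h
  · obtain ⟨x, hx⟩ := hd.2 p q h he
    have h1 := hp.2 x
    have h2 := hq.2 x
    grind
  · obtain ⟨x, hx⟩ := hd.2 q p h he.symm
    have h1 := hp.2 x
    have h2 := hq.2 x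
    grind

/-- Inside the larger interval all entries other than those at its ends exceed `d l'`, so `d p ≤ d
p'` forces `p = p'`. Then `l` is interior, and looking from `l` towards `l'` one sees a column with
entry at least `d l' > d p`, contrary to the choice of the parent. -/
theorem IsParent.lt_of_interval_subset (hd : IsSeparated d) {l p l' p' : Fin t}
    (hp : IsParent d l p) (hp' : IsParent d l' p') (hl : l ≠ l') (h1 : min l' p' ≤ min l p)
    (h2 : max l p ≤ max l' p') : d p' < d p := by
  by_contra! hc
  have hbet : ∀ x, x ≠ l' → x ≠ p' → min l' p' ≤ x → x ≤ max l' p' → d l' < d x := by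
    intro x hx1 hx2 hx3 hx4
    apply hp'.1.lt_of_between hd
    grind
  have hlt := hp'.1.1
  have hltl := hp.1.1
  have hpp : p = p' := by
    by_contra hne
    by_cases he : p = l'
    · subst he
      omega
    · have := hbet p he hne (by grind) (by grind)
      omega
  subst hpp
  have hne := hp.1.ne
  have hl' := hbet l hl hne (by grind) (by grind)
  have hne' := hp'.1.ne
  rcases lt_or_gt_of_ne hl with h | h
  · obtain ⟨q, hq1, hq2, hq⟩ := exists_isVisible_right h hl'
    have h3 := hp.2 q hq
    have h4 := hbet q
    grind
  · obtain ⟨q, hq1, hq2, hq⟩ := exists_isVisible_left h hl'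
    have h3 := hp.2 q hq
    have h4 := hbet q
    grind

end Combinatorics

end TypeA

/-! ### The degeneracy loci and their union -/

namespace TypeA

variable {k : Type*} [Field k] {t : ℕ} {d : Fin t → ℕ}

theorem HasRightInv.mul {a b c : ℕ} {M : Matrix (Fin a) (Fin b) k} {N : Matrix (Fin b) (Fin c) k}
    (hM : HasRightInv M) (hN : HasRightInv N) : HasRightInv (M * N) := by
  obtain ⟨R, hR⟩ := hM
  obtain ⟨R', hR'⟩ := hN
  refine ⟨R' * R, ?_⟩
  rw [Matrix.mul_assoc, ← Matrix.mul_assoc N, hR', Matrix.one_mul, hR]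

theorem HasLeftInv.mul {a b c : ℕ} {M : Matrix (Fin a) (Fin b) k} {N : Matrix (Fin b) (Fin c) k}
    (hM : HasLeftInv M) (hN : HasLeftInv N) : HasLeftInv (M * N) := by
  obtain ⟨L, hL⟩ := hM
  obtain ⟨L', hL'⟩ := hN
  refine ⟨L' * L, ?_⟩
  rw [Matrix.mul_assoc, ← Matrix.mul_assoc L, hL, Matrix.one_mul, hL']

theorem hasRightInv_iff {a b : ℕ} {M : Matrix (Fin a) (Fin b) k} :
    HasRightInv M ↔ a ≤ M.rank :=
  (rank_eq_height_iff M).symm.trans ((Matrix.rank_le_height M).ge_iff_eq).symm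

theorem hasLeftInv_iff {a b : ℕ} {M : Matrix (Fin a) (Fin b) k} :
    HasLeftInv M ↔ b ≤ M.rank :=
  (rank_eq_width_iff M).symm.trans ((Matrix.rank_le_width M).ge_iff_eq).symm

theorem le_rank_mul {a b c : ℕ} {M : Matrix (Fin a) (Fin b) k} {N : Matrix (Fin b) (Fin c) k}
    (hM : HasLeftInv M) (hN : HasRightInv N) : b ≤ (M * N).rank := by
  obtain ⟨L, hL⟩ := hM
  obtain ⟨R, hR⟩ := hN
  have h1 : L * (M * N) * R = 1 := by
    rw [← Matrix.mul_assoc, hL, Matrix.one_mul, hR]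
  have h2 := (Matrix.rank_mul_le_left (L * (M * N)) R).trans (Matrix.rank_mul_le_right L (M * N))
  rwa [h1, Matrix.rank_one, Fintype.card_fin] at h2

variable (k d) in
/-- The locus where the composed map between the vertices `l` and `p` has rank less than `d p`. -/
def degeneracyLocus (l p : Fin t) : Set (Rep k d) := rankLocus k d (min l p) (max l p) (d p)

theorem degeneracyLocus_of_lt {l p : Fin t} (h : l < p) :
    degeneracyLocus k d l p = rankLocus k d l p (d p) := by
  rw [degeneracyLocus, min_eq_left h.le, max_eq_right h.le]

theorem degeneracyLocus_of_gt {l p : Fin t} (h : p < l) :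
    degeneracyLocus k d l p = rankLocus k d p l (d p) := by
  rw [degeneracyLocus, min_eq_right h.le, max_eq_left h.le]

theorem isClosed_degeneracyLocus {l p : Fin t} (h : l ≠ p) :
    IsClosed (degeneracyLocus k d l p) := by
  rcases lt_or_gt_of_ne h with h | h
  · rw [degeneracyLocus_of_lt h]
    exact isClosed_rankLocus_right h.le
  · rw [degeneracyLocus_of_gt h]
    exact isClosed_rankLocus_left h.le

theorem isIrreducible_degeneracyLocus [Infinite k] (hd : IsSeparated d) {l p : Fin t}
    (h : IsVisible d l p) : IsIrreducible (degeneracyLocus k d l p) := by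
  rcases lt_or_gt_of_ne h.ne with hlt | hlt
  · rw [degeneracyLocus_of_lt hlt]
    exact isIrreducible_rankLocus_right hlt (hd.1 p)
      fun x h1 h2 => h.lt_of_between hd (Or.inl ⟨h1, h2⟩)
  · rw [degeneracyLocus_of_gt hlt]
    exact isIrreducible_rankLocus_left hlt (hd.1 p)
      fun x h1 h2 => h.lt_of_between hd (Or.inr ⟨h1, h2⟩)

theorem two_le_codim_degeneracyLocus [Infinite k] (hd : IsSeparated d) {l p : Fin t}
    (h : IsVisible d l p) : 2 ≤ codim (degeneracyLocus k d l p) := by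
  rcases lt_or_gt_of_ne h.ne with hlt | hlt
  · rw [degeneracyLocus_of_lt hlt]
    exact two_le_codim_rankLocus_right hlt (hd.1 p) h.1
      fun x h1 h2 => h.lt_of_between hd (Or.inl ⟨h1, h2⟩)
  · rw [degeneracyLocus_of_gt hlt]
    exact two_le_codim_rankLocus_left hlt (hd.1 p) h.1
      fun x h1 h2 => h.lt_of_between hd (Or.inr ⟨h1, h2⟩)

/-- If `q` is visible from `l` but not its parent `p`, then `p` and `q` lie on opposite sides of
`l`, and `q` is visible from `p`. By induction the map between `p` and `q` has rank at least `d q`;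
it factors through `l`, so the piece between `l` and `q` has that rank too. -/
theorem notMem_degeneracyLocus_of_isVisible (hd : IsSeparated d) {A : Rep k d}
    (hA : ∀ l p, IsParent d l p → A ∉ degeneracyLocus k d l p) {l q : Fin t}
    (hq : IsVisible d l q) : A ∉ degeneracyLocus k d l q := by
  induction hn : d l using Nat.strong_induction_on generalizing l q with
  | _ n ih =>
    subst hn
    obtain ⟨p, hp⟩ := hq.exists_isParent
    by_cases hqp : q = p
    · rw [hqp]
      exact hA l p hp
    have hlt : d q < d p := lt_of_le_of_ne (hp.2 q hq) (hq.entry_ne hd hp.1 hqp)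
    have hpq := ih (d p) hp.1.1 (hp.1.of_opposite hq (Ne.symm hqp) hlt) rfl
    rcases hp.1.opposite hq (Ne.symm hqp) with ⟨h1, h2⟩ | ⟨h1, h2⟩
    · rw [degeneracyLocus_of_gt h1, mem_rankLocus, not_lt]
      rw [degeneracyLocus_of_gt (h1.trans h2), mem_rankLocus, not_lt,
        ← A.path_trans h1.le h2.le] at hpq
      exact hpq.trans (Matrix.rank_mul_le_left _ _)
    · rw [degeneracyLocus_of_lt h2, mem_rankLocus, not_lt]
      rw [degeneracyLocus_of_lt (h1.trans h2), mem_rankLocus, not_lt,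
        ← A.path_trans h1.le h2.le] at hpq
      exact hpq.trans (Matrix.rank_mul_le_right _ _)

/-- Starting at `j`, step repeatedly to the visible column on the left. Such a step never passes
`i`, where the minimum is attained, and each step has a right inverse. -/
theorem hasRightInv_path (hd : IsSeparated d) {A : Rep k d}
    (hA : ∀ l q, IsVisible d l q → A ∉ degeneracyLocus k d l q) {i j : Fin t} (hij : i ≤ j)
    (hmin : ∀ x, i ≤ x → x ≤ j → d i ≤ d x) : HasRightInv (A.path i j) := by
  induction j using WellFoundedLT.induction with
  | _ j ih =>
    rcases hij.lt_or_eq with h | rfl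
    · have hlt : d i < d j := lt_of_le_of_ne (hmin j hij le_rfl) fun he => by
        obtain ⟨x, h1, h2, h3⟩ := hd.2 i j h he
        exact h3.not_ge (hmin x h1.le h2.le)
      obtain ⟨q, hqj, hiq, hq⟩ := exists_isVisible_left h hlt
      have h1 := hA j q hq
      rw [degeneracyLocus_of_gt hqj, mem_rankLocus, not_lt, ← hasRightInv_iff] at h1
      rw [← A.path_trans hiq hqj.le]
      exact (ih q hqj hiq fun x hx hx' => hmin x hx (hx'.trans hqj.le)).mul h1
    · exact ⟨1, by rw [A.path_self, Matrix.one_mul]⟩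

theorem hasLeftInv_path (hd : IsSeparated d) {A : Rep k d}
    (hA : ∀ l q, IsVisible d l q → A ∉ degeneracyLocus k d l q) {i j : Fin t} (hij : i ≤ j)
    (hmin : ∀ x, i ≤ x → x ≤ j → d j ≤ d x) : HasLeftInv (A.path i j) := by
  induction i using WellFoundedGT.induction with
  | _ i ih =>
    rcases hij.lt_or_eq with h | rfl
    · have hlt : d j < d i := lt_of_le_of_ne (hmin i le_rfl hij) fun he => by
        obtain ⟨x, h1, h2, h3⟩ := hd.2 i j h he.symm
        exact (h3.trans_eq he.symm).not_ge (hmin x h1.le h2.le)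
      obtain ⟨q, hiq, hqj, hq⟩ := exists_isVisible_right h hlt
      have h1 := hA i q hq
      rw [degeneracyLocus_of_lt hiq, mem_rankLocus, not_lt, ← hasLeftInv_iff] at h1
      rw [← A.path_trans hiq.le hqj]
      exact h1.mul (ih q hiq hqj fun x hx hx' => hmin x (hiq.le.trans hx) hx')
    · exact ⟨1, by rw [A.path_self, Matrix.one_mul]⟩

theorem mem_genericOrbit_iff {A : Rep k d} : A ∈ genericOrbit k d ↔
    ∀ (i j : Fin t) (h : i < j), (A.path i j).rank = genericRank d i j h.le := by
  constructor
  · intro hA i j h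
    obtain ⟨j, hj⟩ := j
    obtain ⟨n, rfl⟩ := Nat.exists_eq_add_of_lt (show (i : ℕ) < j from h)
    have := hA i (n + 1) hj n.succ_pos
    rwa [A.comp_eq_path] at this
  · intro hA i n h hn
    rw [A.comp_eq_path]
    exact hA i ⟨i + n, h⟩ (by rw [Fin.lt_def]; simp only; omega)

theorem degeneracyLocus_subset_complementY {l p : Fin t} (h : IsVisible d l p) :
    degeneracyLocus k d l p ⊆ complementY k d := by
  intro A hA hO
  have hlt : min l p < max l p := min_lt_max.mpr h.ne
  have h1 : (A.path (min l p) (max l p)).rank < d p := hA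
  rw [mem_genericOrbit_iff.mp hO _ _ hlt] at h1
  refine h1.not_ge (Finset.le_inf' _ _ fun x hx => ?_)
  rw [Finset.mem_Icc] at hx
  have h2 := h.1
  have h3 := h.2 x
  grind

theorem complementY_eq_iUnion (hd : IsSeparated d) {ρ : Fin t} {par : Fin t → Fin t}
    (hpar : ∀ l, l ≠ ρ → IsParent d l (par l))
    (hcover : ∀ l p, IsParent d l p → l ≠ ρ ∧ p = par l) :
    complementY k d = ⋃ l : {l // l ≠ ρ}, degeneracyLocus k d l (par l) := by
  apply Set.Subset.antisymm
  · intro A hA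
    by_contra hc
    simp only [Set.mem_iUnion, not_exists] at hc
    have hvis : ∀ l q, IsVisible d l q → A ∉ degeneracyLocus k d l q := fun l q =>
      notMem_degeneracyLocus_of_isVisible hd fun l p hp => by
        obtain ⟨hl, rfl⟩ := hcover l p hp
        exact hc ⟨l, hl⟩
    refine hA (mem_genericOrbit_iff.mpr fun i j hij => le_antisymm ?_ ?_)
    · refine Finset.le_inf' _ _ fun x hx => ?_
      rw [Finset.mem_Icc] at hx
      exact A.rank_path_le hx.1 hx.2
    -- At a minimal column `q` the path splits into a factor with a left inverse and one with a
    -- right inverse, so its rank is at least `d q`.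
    · obtain ⟨q, hq, he⟩ := Finset.exists_mem_eq_inf' (Finset.nonempty_Icc.mpr hij.le) d
      have hmin : ∀ x, i ≤ x → x ≤ j → d q ≤ d x := fun x h1 h2 =>
        he ▸ Finset.inf'_le d (Finset.mem_Icc.mpr ⟨h1, h2⟩)
      rw [Finset.mem_Icc] at hq
      rw [genericRank, he, ← A.path_trans hq.1 hq.2]
      exact le_rank_mul
        (hasLeftInv_path hd hvis hq.1 fun x h1 h2 => hmin x h1 (h2.trans hq.2))
        (hasRightInv_path hd hvis hq.2 fun x h1 h2 => hmin x (hq.1.trans h1) h2)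
  · exact Set.iUnion_subset fun l => degeneracyLocus_subset_complementY (hpar l l.2).1

/-! ### Representations separating the loci -/

/-- The diagonal representation with the arrow `m₀` in row `r` removed. -/
def edgeDeleted (k : Type*) [Field k] (d : Fin t → ℕ) (m₀ : Fin (t - 1)) (r : ℕ) : Rep k d :=
  diagRep d fun m x => if m = m₀ ∧ x = r then 0 else 1

theorem edgeDeleted_path_eq_zero {m₀ : Fin (t - 1)} {r : ℕ} {i j : Fin t} (h1 : i ≤ lo m₀)
    (h2 : hi m₀ ≤ j) (x : Fin (d i)) (y : Fin (d j)) (h : (x : ℕ) = r ∨ (y : ℕ) = r) :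
    (edgeDeleted k d m₀ r).path i j x y = 0 := by
  by_contra hc
  obtain ⟨hxy, hε⟩ := diagRep_path_ne_zero ((h1.trans (lo_lt_hi m₀).le).trans h2) x y hc
  exact hε m₀ h1 h2 (if_pos ⟨rfl, by omega⟩)

theorem edgeDeleted_path_apply {m₀ : Fin (t - 1)} {r s : ℕ} {i j : Fin t} (hij : i ≤ j)
    (hs : ∀ l, i ≤ l → l ≤ j → s ≤ d l) (h : (i ≤ lo m₀ ∧ hi m₀ ≤ j) → s ≤ r) (x : Fin (d i))
    (y : Fin (d j)) (hxy : (x : ℕ) < s ∨ (y : ℕ) < s) :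
    (edgeDeleted k d m₀ r).path i j x y = if (x : ℕ) = y then 1 else 0 := by
  split_ifs with he
  · refine diagRep_path_eq_one (r := x) hij (fun l h1 h2 => ?_) (fun m h1 h2 => if_neg ?_) x y rfl
      he.symm
    · have := hs l h1 h2
      omega
    · rintro ⟨rfl, hr⟩
      have := h ⟨h1, h2⟩
      omega
  · by_contra hc
    exact he (diagRep_path_ne_zero hij x y hc).1

theorem edgeDeleted_mem_degeneracyLocus {m₀ : Fin (t - 1)} {l p : Fin t} (hlp : l ≠ p)
    (hp : 0 < d p) (h1 : min l p ≤ lo m₀) (h2 : hi m₀ ≤ max l p) :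
    edgeDeleted k d m₀ (d p - 1) ∈ degeneracyLocus k d l p := by
  have hsingle : (Pi.single ⟨d p - 1, by omega⟩ 1 : Fin (d p) → k) ≠ 0 := fun h0 =>
    one_ne_zero ((Pi.single_eq_same _ _).symm.trans (congrFun h0 _))
  rcases lt_or_gt_of_ne hlp with h | h
  · rw [min_eq_left h.le] at h1
    rw [max_eq_right h.le] at h2
    rw [degeneracyLocus_of_lt h, mem_rankLocus]
    refine rank_lt_of_mulVec_eq_zero _ _ hsingle ?_
    ext x
    rw [Matrix.mulVec_single_one, Matrix.col_apply]
    exact edgeDeleted_path_eq_zero h1 h2 _ _ (Or.inr rfl)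
  · rw [min_eq_right h.le] at h1
    rw [max_eq_left h.le] at h2
    rw [degeneracyLocus_of_gt h, mem_rankLocus]
    refine rank_lt_of_vecMul_eq_zero _ _ hsingle ?_
    ext y
    rw [Matrix.single_one_vecMul, Matrix.row_apply]
    exact edgeDeleted_path_eq_zero h1 h2 _ _ (Or.inl rfl)

theorem edgeDeleted_notMem_degeneracyLocus {m₀ : Fin (t - 1)} {r : ℕ} {l p : Fin t}
    (hv : IsVisible d l p) (h : (min l p ≤ lo m₀ ∧ hi m₀ ≤ max l p) → d p ≤ r) :
    edgeDeleted k d m₀ r ∉ degeneracyLocus k d l p := by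
  have hs : ∀ x, min l p ≤ x → x ≤ max l p → d p ≤ d x := fun x h1 h2 => by
    have h3 := hv.1
    have h4 := hv.2 x
    grind
  rcases lt_or_gt_of_ne hv.ne with hlt | hlt
  · rw [min_eq_left hlt.le, max_eq_right hlt.le] at h hs
    rw [degeneracyLocus_of_lt hlt, mem_rankLocus, not_lt, ← hasLeftInv_iff]
    refine ⟨Matrix.of fun y x => if (x : ℕ) = y then 1 else 0, ?_⟩
    ext y y'
    rw [Matrix.mul_apply, Finset.sum_eq_single ⟨y, y.2.trans hv.1⟩]
    · rw [Matrix.of_apply, edgeDeleted_path_apply hlt.le hs h _ _ (Or.inr y'.2), if_pos rfl,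
        one_mul, Matrix.one_apply]
      simp only [Fin.ext_iff]
    · intro z _ hz
      rw [Matrix.of_apply, if_neg fun he => hz (Fin.ext he), zero_mul]
    · intro hc
      exact absurd (Finset.mem_univ _) hc
  · rw [min_eq_right hlt.le, max_eq_left hlt.le] at h hs
    rw [degeneracyLocus_of_gt hlt, mem_rankLocus, not_lt, ← hasRightInv_iff]
    refine ⟨Matrix.of fun y x => if (y : ℕ) = x then 1 else 0, ?_⟩
    ext x x'
    rw [Matrix.mul_apply, Finset.sum_eq_single ⟨x', x'.2.trans hv.1⟩]
    · rw [Matrix.of_apply, edgeDeleted_path_apply hlt.le hs h _ _ (Or.inl x.2), if_pos rfl, mul_one,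
        Matrix.one_apply]
      simp only [Fin.ext_iff]
    · intro z _ hz
      rw [Matrix.of_apply, if_neg fun he => hz (Fin.ext he), mul_zero]
    · intro hc
      exact absurd (Finset.mem_univ _) hc

/-- Delete an arrow between `l` and `p` in the last row counted by `d p`; with rows numbered from 0
this is row `d p - 1`. If the interval of `(l, p)` sticks out of that of `(l', p')`, an arrow at its
end avoids the latter. Otherwise `d p' < d p`, and the deleted row is not among the first `d p'`. -/
theorem not_degeneracyLocus_subset (hd : IsSeparated d) {l p l' p' : Fin t} (hp : IsParent d l p)
    (hp' : IsParent d l' p') (hl : l ≠ l') :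
    ¬ degeneracyLocus k d l p ⊆ degeneracyLocus k d l' p' := by
  have hlt : min l p < max l p := min_lt_max.mpr hp.1.ne
  suffices ∃ m : Fin (t - 1), (min l p ≤ lo m ∧ hi m ≤ max l p) ∧
      ((min l' p' ≤ lo m ∧ hi m ≤ max l' p') → d p' ≤ d p - 1) by
    obtain ⟨m, ⟨h1, h2⟩, h3⟩ := this
    intro hsub
    exact edgeDeleted_notMem_degeneracyLocus hp'.1 h3
      (hsub (edgeDeleted_mem_degeneracyLocus hp.1.ne (hd.1 p) h1 h2))
  obtain ⟨m₁, hm₁⟩ := exists_lo_eq hlt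
  obtain ⟨m₂, hm₂⟩ := exists_hi_eq hlt
  by_cases h1 : min l' p' ≤ min l p
  · by_cases h2 : max l p ≤ max l' p'
    · have := hp.lt_of_interval_subset hd hp' hl h1 h2
      exact ⟨m₁, ⟨hm₁.ge, lo_lt_iff.mp (hm₁.trans_lt hlt)⟩, fun _ => by omega⟩
    · exact ⟨m₂, ⟨lt_hi_iff.mp (hlt.trans_eq hm₂.symm), hm₂.le⟩,
        fun h => absurd (hm₂.symm.trans_le h.2) h2⟩
  · exact ⟨m₁, ⟨hm₁.ge, lo_lt_iff.mp (hm₁.trans_lt hlt)⟩,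
      fun h => absurd (h.1.trans hm₁.le) h1⟩

theorem IsParent.unique (hd : IsSeparated d) {l p q : Fin t} (hp : IsParent d l p)
    (hq : IsParent d l q) : p = q := by
  by_contra hne
  exact hp.1.entry_ne hd hq.1 hne (le_antisymm (hq.2 p hp.1) (hp.2 q hq.1))

end TypeA

theorem mainTheorem9 {k : Type*} [Field k] [Infinite k] {t : ℕ} (ht : 1 ≤ t) (d : Fin t → ℕ)
    (hd : TypeA.IsGeneric d) :
    (TypeA.components (TypeA.complementY k d)).encard = ((t - 1 : ℕ) : ℕ∞) ∧
      ∀ Z ∈ TypeA.components (TypeA.complementY k d), 2 ≤ TypeA.codim Z := by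
  have hs := hd.isSeparated
  obtain ⟨ρ, hρ, hmin⟩ := hs.exists_root ht
  -- The value of `par` at `ρ` is arbitrary and plays no role.
  choose! par hpar using hρ
  have hcover : ∀ l p, TypeA.IsParent d l p → l ≠ ρ ∧ p = par l := by
    intro l p hp
    have hl : l ≠ ρ := by
      rintro rfl
      exact hp.1.1.not_ge (hmin p)
    exact ⟨hl, hp.unique hs (hpar l hl)⟩
  have hsub : ∀ l l' : {l // l ≠ ρ}, TypeA.degeneracyLocus k d l (par l) ⊆
      TypeA.degeneracyLocus k d l' (par l') → l = l' := by
    intro l l' h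
    by_contra hne
    exact TypeA.not_degeneracyLocus_subset hs (hpar l l.2) (hpar l' l'.2)
      (fun he => hne (Subtype.ext he)) h
  have hcomp := TypeA.components_eq_range
    (fun l : {l // l ≠ ρ} => TypeA.isClosed_degeneracyLocus (k := k) (hpar l l.2).1.ne)
    (fun l => TypeA.isIrreducible_degeneracyLocus hs (hpar l l.2).1)
    (TypeA.complementY_eq_iUnion hs hpar hcover) hsub
  rw [hcomp]
  constructor
  · have hinj : Function.Injective
        fun l : {l // l ≠ ρ} => TypeA.degeneracyLocus k d l (par l) :=
      fun l l' h => hsub l l' (le_of_eq h)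
    rw [← Set.image_univ, hinj.encard_image, Set.encard_univ, ENat.card_eq_coe_fintype_card,
      Fintype.card_subtype_compl, Fintype.card_fin, Fintype.card_subtype_eq]
  · rintro _ ⟨l, rfl⟩
    exact TypeA.two_le_codim_degeneracyLocus hs (hpar l l.2).1
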